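/- Let $n\ge 0$ be an integer. For $0\le r\le n$, an $r$-dimensional subcube of $\{0,1\}^n$ is a set of the form $\{x\in\{0,1\}^n : x_i=a_i \text{ for all } i\notin J\}$, where $J\subseteq\{1,\dots,n\}$ has $r$ elements and $a\in\{0,1\}^n$. Let $S$ be a uniformly random subset of $\{0,1\}^n$ (each of the $2^{2^n}$ subsets being equally likely), let $X_1=X_1(S)$ be the number of edges ($1$-dimensional subcubes) of $\{0,1\}^n$ contained in $S$, and let $\mu_1(n)=\mathbb E[X_1]$. Then, for every $n$, $$\mathbb E[(X_1-\mu_1(n))^3]=\frac{3n^3 2^n}{64},$$ $$\mathbb E[(X_1-\mu_1(n))^4]=\frac{n2^n}{1024}\bigl(12n^3 2^n+12n^2 2^n+40n^3+3n2^n-48n^2+12n-16\bigr),$$ $$\mathbb E[(X_1-\mu_1(n))^5]=\frac{5n^3 2^n}{1024}\bigl(6n^2 2^n+3n2^n+4n^2-24n+8\bigr),$$ $$\begin{aligned}\mathbb E[(X_1-\mu_1(n))^6]=\frac{n2^n}{32768}\bigl(&120n^5(2^n)^2+180n^4(2^n)^2+1920n^5 2^n+90n^3(2^n)^2-840n^4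 2^n-1792n^5\\&+15n^2(2^n)^2-360n^3 2^n-5280n^4-300n^2 2^n+3840n^3-240n2^n+3840n^2-6720n+4864\bigr).\end{aligned}$$ Moreover, the scaled central moments $$\mathbb E\left[\left(\frac{X_1-\mu_1(n)}{\sqrt{\operatorname{Var}(X_1)}}\right)^k\right]$$ converge, as $n\to\infty$, to $0,3,0,15$ for $k=3,4,5,6$ respectively. -/

import Mathlib

/-- The discrete cube `{0,1}^n`. -/
abbrev Cube (n : ℕ) : Type := Fin n → Bool

/-- `C` is an `r`-dimensional subcube of `{0,1}^n`: for some set `J` of `r` free coordinates and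
some vertex `a`, it consists of all vertices that agree with `a` outside `J`. -/
def IsSubcube {n : ℕ} (r : ℕ) (C : Finset (Cube n)) : Prop :=
  ∃ (J : Finset (Fin n)) (a : Cube n),
    J.card = r ∧ ∀ x : Cube n, x ∈ C ↔ ∀ i, i ∉ J → x i = a i

open Classical in
/-- The finite set of all `r`-dimensional subcubes of `{0,1}^n`. -/
noncomputable def subcubes (n r : ℕ) : Finset (Finset (Cube n)) :=
  Finset.univ.filter (fun C => IsSubcube r C)

open Classical in
/-- The random variable `X_r`: the number of `r`-dimensional subcubes of `{0,1}^n` that are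
contained in the set of vertices `S`. -/
noncomputable def numSubcubes (n r : ℕ) (S : Finset (Cube n)) : ℝ :=
  (((subcubes n r).filter (fun C => C ⊆ S)).card : ℝ)

/-- The law of a uniformly random subset of `{0,1}^n`: the uniform probability measure on the
`2 ^ (2 ^ n)` subsets. -/
noncomputable def randomSubset (n : ℕ) : MeasureTheory.Measure (Finset (Cube n)) :=
  (PMF.uniformOfFintype (Finset (Cube n))).toMeasure

/-- The scaled `k`-th central moment `E[((X_r - μ_r) / √Var(X_r)) ^ k]` of `X_r`. -/
noncomputable def scaledCentralMoment (n r k : ℕ) : ℝ :=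
  ∫ S, ((numSubcubes n r S - ∫ T, numSubcubes n r T ∂(randomSubset n)) /
    √(ProbabilityTheory.variance (numSubcubes n r) (randomSubset n))) ^ k ∂(randomSubset n)

/-!
Encode a random set of vertices by independent signs `s x = ±1`. The cube is a bipartite graph, so
the centred number of edges is an affine form in the signs of the odd vertices whose coefficients
depend only on the signs of the even ones. Averaging over the odd signs first, its moments become
polynomials in the power sums of these coefficients. The sum of their squares is a constant plus a
linear and a quadratic form in the even signs whose matrix counts common neighbours, so the
remaining averages reduce to its row sums and to the numbers of closed walks of lengths `4` and `6`
in the cube, which Walsh characters turn into moments of a sum of `n` independent signs.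
-/

open Finset Function
open scoped BigOperators

section SignMean

variable {α : Type*} [DecidableEq α]

/-- The `±1` indicator of a finite set. -/
def memberSign (S : Finset α) (x : α) : ℝ := if x ∈ S then 1 else -1

lemma memberSign_mul_self (S : Finset α) (x : α) : memberSign S x * memberSign S x = 1 := by
  unfold memberSign
  split_ifs <;> norm_num

lemma memberSign_symmDiff_singleton (S : Finset α) (x : α) :
    memberSign (symmDiff {x} S) = update (memberSign S) x (-memberSign S x) := by
  funext y
  obtain rfl | h := eq_or_ne y x
  · by_cases hy : y ∈ S <;> simp [memberSign, mem_symmDiff, hy]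
  · simp [memberSign, mem_symmDiff, h]

variable [Fintype α]

lemma memberSign_compl (S : Finset α) : memberSign Sᶜ = -memberSign S := by
  funext x
  by_cases h : x ∈ S <;> simp [memberSign, h]

/-- The expectation of `F s` for independent uniformly distributed signs `s x = ±1`, encoded as
the average over the `±1` indicators of all finite sets. -/
noncomputable def signMean (F : (α → ℝ) → ℝ) : ℝ := 𝔼 S : Finset α, F (memberSign S)

variable {F G : (α → ℝ) → ℝ}

lemma signMean_congr (h : ∀ s : α → ℝ, (∀ x, s x * s x = 1) → F s = G s) :
    signMean F = signMean G :=
  expect_congr rfl fun S _ => h _ (memberSign_mul_self S)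

lemma signMean_const (c : ℝ) : signMean (fun _ : α → ℝ => c) = c := Fintype.expect_const c

lemma signMean_add : signMean (fun s => F s + G s) = signMean F + signMean G :=
  expect_add_distrib ..

lemma signMean_const_mul (c : ℝ) (F : (α → ℝ) → ℝ) :
    signMean (fun s => c * F s) = c * signMean F :=
  (mul_expect ..).symm

lemma signMean_sum {ι : Type*} (T : Finset ι) (F : ι → (α → ℝ) → ℝ) :
    signMean (fun s => ∑ i ∈ T, F i s) = ∑ i ∈ T, signMean (F i) :=
  expect_sum_comm ..

lemma signMean_neg (F : (α → ℝ) → ℝ) : signMean (fun s => F (-s)) = signMean F :=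
  Fintype.expect_equiv compl_involutive.toPerm _ _ fun S =>
    congrArg F (memberSign_compl S).symm

lemma signMean_update_neg (F : (α → ℝ) → ℝ) (x : α) :
    signMean (fun s => F (update s x (-s x))) = signMean F :=
  Fintype.expect_equiv (symmDiff_right_involutive ({x} : Finset α)).toPerm _ _ fun S =>
    congrArg F (memberSign_symmDiff_singleton S x).symm

lemma signMean_eq_zero_of_odd (h : ∀ s, F (-s) = -F s) : signMean F = 0 := by
  have hneg : signMean (fun s => -1 * F s) = signMean F := by
    simpa only [h, neg_one_mul] using signMean_neg F
  rw [signMean_const_mul] at hneg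
  linarith

lemma signMean_eq_average_update (F : (α → ℝ) → ℝ) (x : α) :
    signMean F = (signMean (fun s => F (update s x 1)) +
      signMean fun s => F (update s x (-1))) / 2 := by
  have hsum : signMean (fun s => F s + F (update s x (-s x))) =
      signMean fun s => F (update s x 1) + F (update s x (-1)) := by
    refine signMean_congr fun s hs => ?_
    have hx : update s x (s x) = s := update_eq_self x s
    obtain h | h := mul_self_eq_one_iff.1 (hs x) <;> rw [h] at hx ⊢
    · rw [hx]
    · rw [neg_neg, hx, add_comm]
  rw [signMean_add, signMean_add, signMean_update_neg] at hsum
  linarith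

lemma signMean_eq_of_average_update (x : α)
    (h : ∀ s : α → ℝ, (F (update s x 1) + F (update s x (-1))) / 2 = G s) :
    signMean F = signMean G := by
  have : signMean G = 2⁻¹ * signMean fun s => F (update s x 1) + F (update s x (-1)) := by
    rw [← signMean_const_mul]
    exact signMean_congr fun s _ => by rw [← h s]; ring
  rw [this, signMean_add, signMean_eq_average_update F x]
  ring

lemma signMean_piecewise (F : (α → ℝ) → ℝ) (T : Finset α) :
    (signMean fun s => signMean fun t => F (T.piecewise s t)) = signMean F := by
  induction T using Finset.induction_on generalizing F with
  | empty => simp only [piecewise_empty, signMean_const]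
  | insert x T hx ih =>
    have hupdate (c : ℝ) (s t : α → ℝ) :
        (insert x T).piecewise (update s x c) t = update (T.piecewise s t) x c := by
      rw [piecewise_insert, update_self, T.piecewise_congr
        (fun y hy => update_of_ne (ne_of_mem_of_not_mem hy hx) c s) fun _ _ => rfl]
    rw [signMean_eq_average_update _ x, signMean_eq_average_update F x]
    simp only [hupdate]
    rw [ih fun s => F (update s x 1), ih fun s => F (update s x (-1))]

end SignMean

section LinearForm

variable {α : Type*}

/-- The linear form `∑ x ∈ T, w x * s x` in the signs `s`. -/
def linearForm (T : Finset α) (w s : α → ℝ) : ℝ := ∑ x ∈ T, w x * s x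

lemma linearForm_empty (w s : α → ℝ) : linearForm ∅ w s = 0 := sum_empty

lemma linearForm_neg (T : Finset α) (w s : α → ℝ) :
    linearForm T w (-s) = -linearForm T w s := by
  simp [linearForm]

lemma linearForm_congr {T : Finset α} {w s t : α → ℝ} (h : ∀ x ∈ T, s x = t x) :
    linearForm T w s = linearForm T w t :=
  sum_congr rfl fun x hx => by rw [h x hx]

variable [DecidableEq α] {T : Finset α} {x : α}

lemma linearForm_update_of_notMem (hx : x ∉ T) (w s : α → ℝ) (c : ℝ) :
    linearForm T w (update s x c) = linearForm T w s :=
  linearForm_congr fun _ hy => update_of_ne (ne_of_mem_of_not_mem hy hx) c s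

lemma linearForm_insert_update (hx : x ∉ T) (w s : α → ℝ) (c : ℝ) :
    linearForm (insert x T) w (update s x c) = w x * c + linearForm T w s := by
  rw [← linearForm_update_of_notMem hx w s c, linearForm, sum_insert hx, update_self, linearForm]

variable [Fintype α]

lemma signMean_add_linearForm_insert (hx : x ∉ T) (w : α → ℝ) (a : ℝ) (k : ℕ) :
    signMean (fun s => (a + linearForm (insert x T) w s) ^ k) =
      (signMean (fun s => (a + w x + linearForm T w s) ^ k) +
        signMean fun s => (a - w x + linearForm T w s) ^ k) / 2 := by
  rw [signMean_eq_average_update _ x]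
  simp only [linearForm_insert_update hx, mul_one, mul_neg, ← add_assoc, ← sub_eq_add_neg]

lemma signMean_add_linearForm_pow_two (T : Finset α) (w : α → ℝ) (a : ℝ) :
    signMean (fun s => (a + linearForm T w s) ^ 2) = a ^ 2 + ∑ x ∈ T, w x ^ 2 := by
  induction T using Finset.induction_on generalizing a with
  | empty => simp [linearForm_empty, signMean_const]
  | insert x T hx ih =>
    rw [signMean_add_linearForm_insert hx, ih, ih, sum_insert hx]
    ring

lemma signMean_add_linearForm_pow_three (T : Finset α) (w : α → ℝ) (a : ℝ) :
    signMean (fun s => (a + linearForm T w s) ^ 3) = a ^ 3 + 3 * a * ∑ x ∈ T, w x ^ 2 := by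
  induction T using Finset.induction_on generalizing a with
  | empty => simp [linearForm_empty, signMean_const]
  | insert x T hx ih =>
    rw [signMean_add_linearForm_insert hx, ih, ih, sum_insert hx]
    ring

lemma signMean_add_linearForm_pow_four (T : Finset α) (w : α → ℝ) (a : ℝ) :
    signMean (fun s => (a + linearForm T w s) ^ 4) =
      a ^ 4 + 6 * a ^ 2 * ∑ x ∈ T, w x ^ 2 +
        (3 * (∑ x ∈ T, w x ^ 2) ^ 2 - 2 * ∑ x ∈ T, w x ^ 4) := by
  induction T using Finset.induction_on generalizing a with
  | empty => simp [linearForm_empty, signMean_const]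
  | insert x T hx ih =>
    rw [signMean_add_linearForm_insert hx, ih, ih, sum_insert hx, sum_insert hx]
    ring

lemma signMean_add_linearForm_pow_five (T : Finset α) (w : α → ℝ) (a : ℝ) :
    signMean (fun s => (a + linearForm T w s) ^ 5) =
      a ^ 5 + 10 * a ^ 3 * ∑ x ∈ T, w x ^ 2 +
        5 * a * (3 * (∑ x ∈ T, w x ^ 2) ^ 2 - 2 * ∑ x ∈ T, w x ^ 4) := by
  induction T using Finset.induction_on generalizing a with
  | empty => simp [linearForm_empty, signMean_const]
  | insert x T hx ih =>
    rw [signMean_add_linearForm_insert hx, ih, ih, sum_insert hx, sum_insert hx]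
    ring

lemma signMean_add_linearForm_pow_six (T : Finset α) (w : α → ℝ) (a : ℝ) :
    signMean (fun s => (a + linearForm T w s) ^ 6) =
      a ^ 6 + 15 * a ^ 4 * ∑ x ∈ T, w x ^ 2 +
        15 * a ^ 2 * (3 * (∑ x ∈ T, w x ^ 2) ^ 2 - 2 * ∑ x ∈ T, w x ^ 4) +
        (15 * (∑ x ∈ T, w x ^ 2) ^ 3 - 30 * (∑ x ∈ T, w x ^ 2) * ∑ x ∈ T, w x ^ 4 +
          16 * ∑ x ∈ T, w x ^ 6) := by
  induction T using Finset.induction_on generalizing a with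
  | empty => simp [linearForm_empty, signMean_const]
  | insert x T hx ih =>
    rw [signMean_add_linearForm_insert hx, ih, ih, sum_insert hx, sum_insert hx, sum_insert hx]
    ring

lemma signMean_linearForm_mul_linearForm (T : Finset α) (u v : α → ℝ) :
    signMean (fun s => linearForm T u s * linearForm T v s) = ∑ x ∈ T, u x * v x := by
  induction T using Finset.induction_on with
  | empty => simp [linearForm_empty, signMean_const]
  | insert x T hx ih =>
    rw [signMean_eq_of_average_update (G := fun s =>
      linearForm T u s * linearForm T v s + u x * v x) x, signMean_add, signMean_const, ih,
      sum_insert hx, add_comm]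
    intro s
    simp only [linearForm_insert_update hx]
    ring

lemma signMean_eval_mul (F : (α → ℝ) → ℝ) (x : α) :
    signMean (fun s => s x * F s) =
      (signMean (fun s => F (update s x 1)) - signMean fun s => F (update s x (-1))) / 2 := by
  rw [signMean_eq_average_update _ x]
  simp only [update_self, one_mul, signMean_const_mul]
  ring

lemma signMean_eval_mul_add_linearForm_pow (hx : x ∉ T) (w : α → ℝ) (a : ℝ) (k : ℕ) :
    signMean (fun s => s x * (a + linearForm (insert x T) w s) ^ k) =
      (signMean (fun s => (a + w x + linearForm T w s) ^ k) -
        signMean fun s => (a - w x + linearForm T w s) ^ k) / 2 := by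
  rw [signMean_eval_mul]
  simp only [linearForm_insert_update hx, mul_one, mul_neg, ← add_assoc, ← sub_eq_add_neg]

lemma signMean_eval_mul_add_linearForm_pow_four (hx : x ∈ T) (w : α → ℝ) (a : ℝ) :
    signMean (fun s => s x * (a + linearForm T w s) ^ 4) =
      w x * (4 * a ^ 3 + 12 * a * ∑ z ∈ T, w z ^ 2 - 8 * a * w x ^ 2) := by
  have hxT := notMem_erase x T
  rw [← insert_erase hx, signMean_eval_mul_add_linearForm_pow hxT,
    signMean_add_linearForm_pow_four, signMean_add_linearForm_pow_four, sum_insert hxT]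
  ring

lemma signMean_eval_mul_eval_mul_add_linearForm_pow_four {y : α} (hx : x ∈ T) (hy : y ∈ T)
    (hxy : x ≠ y) (w : α → ℝ) (a : ℝ) :
    signMean (fun s => s x * s y * (a + linearForm T w s) ^ 4) =
      w x * w y * (12 * a ^ 2 + 12 * ∑ z ∈ T, w z ^ 2 - 8 * w x ^ 2 - 8 * w y ^ 2) := by
  have hxT := notMem_erase x T
  have hyT : y ∈ T.erase x := mem_erase.2 ⟨hxy.symm, hy⟩
  simp only [mul_assoc (_ : ℝ) _ (_ ^ 4)]
  rw [← insert_erase hx, signMean_eval_mul]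
  simp only [linearForm_insert_update hxT, update_of_ne hxy.symm, ← add_assoc]
  rw [signMean_eval_mul_add_linearForm_pow_four hyT, signMean_eval_mul_add_linearForm_pow_four hyT,
    sum_insert hxT]
  ring

end LinearForm

section QuadForm

variable {α : Type*}

/-- The quadratic form `∑ x ∈ T, ∑ y ∈ T, B x y * s x * s y` in the signs `s`. -/
def quadForm (T : Finset α) (B : Matrix α α ℝ) (s : α → ℝ) : ℝ :=
  ∑ x ∈ T, ∑ y ∈ T, B x y * (s x * s y)

/-- Symmetric matrices with zero diagonal: the coefficient matrices of the quadratic forms in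
signs that have no constant part. -/
structure IsHollowSymm (B : Matrix α α ℝ) : Prop where
  symm : B.IsSymm
  diag_eq_zero : ∀ x, B x x = 0

lemma quadForm_empty (B : Matrix α α ℝ) (s : α → ℝ) : quadForm ∅ B s = 0 := sum_empty

lemma quadForm_neg (T : Finset α) (B : Matrix α α ℝ) (s : α → ℝ) :
    quadForm T B (-s) = quadForm T B s := by
  simp [quadForm]

variable [DecidableEq α] {T : Finset α} {x : α} {B C D : Matrix α α ℝ}

lemma sum_sum_insert_of_symm {f : α → α → ℝ} (hf : ∀ y z, f y z = f z y) (hx : x ∉ T)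
    (hfx : f x x = 0) :
    ∑ y ∈ insert x T, ∑ z ∈ insert x T, f y z =
      2 * ∑ y ∈ T, f x y + ∑ y ∈ T, ∑ z ∈ T, f y z := by
  simp only [sum_insert hx, sum_add_distrib, hfx, hf _ x]
  ring

lemma IsHollowSymm.quadForm_insert_update (hB : IsHollowSymm B) (hx : x ∉ T) (s : α → ℝ)
    (c : ℝ) :
    quadForm (insert x T) B (update s x c) = 2 * c * linearForm T (B x) s + quadForm T B s := by
  have hT : ∀ y ∈ T, update s x c y = s y := fun y hy =>
    update_of_ne (ne_of_mem_of_not_mem hy hx) c s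
  have hcross : ∑ y ∈ T, B x y * (update s x c x * update s x c y) = c * linearForm T (B x) s := by
    rw [linearForm, mul_sum]
    exact sum_congr rfl fun y hy => by rw [update_self, hT y hy]; ring
  have hrest : ∑ y ∈ T, ∑ z ∈ T, B y z * (update s x c y * update s x c z) = quadForm T B s :=
    sum_congr rfl fun y hy => sum_congr rfl fun z hz => by rw [hT y hy, hT z hz]
  rw [quadForm, sum_sum_insert_of_symm
    (fun y z => by rw [hB.symm.apply, mul_comm (update s x c y)]) hx
    (by rw [hB.diag_eq_zero, zero_mul]), hcross, hrest]
  ring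

lemma IsHollowSymm.sum_sum_sum_insert (hB : IsHollowSymm B) (hC : IsHollowSymm C)
    (hD : IsHollowSymm D) (hx : x ∉ T) :
    ∑ y ∈ insert x T, ∑ z ∈ insert x T, ∑ t ∈ insert x T, B y z * C z t * D t y =
      ∑ y ∈ T, ∑ z ∈ T, ∑ t ∈ T, B y z * C z t * D t y +
        (∑ y ∈ T, ∑ z ∈ T, C y z * (B x y * D x z) + ∑ y ∈ T, ∑ z ∈ T, D y z * (B x y * C x z) +
          ∑ y ∈ T, ∑ z ∈ T, B y z * (D x y * C x z)) := by
  have hBx : ∑ y ∈ T, ∑ z ∈ T, B x y * C y z * D z x =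
      ∑ y ∈ T, ∑ z ∈ T, C y z * (B x y * D x z) :=
    sum_congr rfl fun y _ => sum_congr rfl fun z _ => by rw [hD.symm.apply]; ring
  have hxD : ∑ y ∈ T, ∑ z ∈ T, B y x * C x z * D z y =
      ∑ y ∈ T, ∑ z ∈ T, D y z * (B x y * C x z) :=
    sum_congr rfl fun y _ => sum_congr rfl fun z _ => by
      rw [hB.symm.apply, hD.symm.apply]; ring
  have hCx : ∑ y ∈ T, ∑ z ∈ T, B y z * C z x * D x y =
      ∑ y ∈ T, ∑ z ∈ T, B y z * (D x y * C x z) :=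
    sum_congr rfl fun y _ => sum_congr rfl fun z _ => by rw [hC.symm.apply]; ring
  simp only [sum_insert hx, sum_add_distrib, hB.diag_eq_zero, hC.diag_eq_zero, hD.diag_eq_zero,
    hBx, hxD, hCx, mul_zero, zero_mul, sum_const_zero, zero_add]
  ring

variable [Fintype α]

lemma IsHollowSymm.signMean_quadForm (hB : IsHollowSymm B) (T : Finset α) :
    signMean (quadForm T B) = 0 := by
  induction T using Finset.induction_on with
  | empty => exact signMean_const 0
  | insert x T hx ih =>
    rw [signMean_eq_of_average_update x, ih]
    intro s
    rw [hB.quadForm_insert_update hx, hB.quadForm_insert_update hx]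
    ring

lemma IsHollowSymm.signMean_quadForm_mul_linearForm_mul_linearForm (hB : IsHollowSymm B)
    (T : Finset α) (u v : α → ℝ) :
    signMean (fun s => quadForm T B s * (linearForm T u s * linearForm T v s)) =
      2 * ∑ x ∈ T, ∑ y ∈ T, B x y * (u x * v y) := by
  induction T using Finset.induction_on with
  | empty => simp [quadForm_empty, signMean_const]
  | insert x T hx ih =>
    rw [signMean_eq_of_average_update (G := fun s =>
      quadForm T B s * (linearForm T u s * linearForm T v s) + u x * v x * quadForm T B s +
        (2 * u x * (linearForm T (B x) s * linearForm T v s) +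
          2 * v x * (linearForm T (B x) s * linearForm T u s))) x]
    · have hu : ∑ y ∈ T, B x y * (u x * v y) = u x * ∑ y ∈ T, B x y * v y := by
        simp only [mul_sum, mul_left_comm]
      have hv : ∑ y ∈ T, B x y * (u y * v x) = v x * ∑ y ∈ T, B x y * u y := by
        rw [mul_sum]
        exact sum_congr rfl fun y _ => by ring
      simp only [signMean_add, signMean_const_mul, ih, hB.signMean_quadForm,
        signMean_linearForm_mul_linearForm, sum_insert hx, sum_add_distrib, hB.diag_eq_zero,
        hB.symm.apply x, hu, hv]
      ring
    · intro s
      simp only [hB.quadForm_insert_update hx, linearForm_insert_update hx]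
      ring

lemma IsHollowSymm.signMean_quadForm_mul_quadForm (hB : IsHollowSymm B) (hC : IsHollowSymm C)
    (T : Finset α) :
    signMean (fun s => quadForm T B s * quadForm T C s) =
      2 * ∑ x ∈ T, ∑ y ∈ T, B x y * C x y := by
  induction T using Finset.induction_on with
  | empty => simp [quadForm_empty, signMean_const]
  | insert x T hx ih =>
    rw [signMean_eq_of_average_update (G := fun s =>
      quadForm T B s * quadForm T C s + 4 * (linearForm T (B x) s * linearForm T (C x) s)) x,
      signMean_add, signMean_const_mul, ih, signMean_linearForm_mul_linearForm,
      sum_sum_insert_of_symm (fun y z => by rw [hB.symm.apply, hC.symm.apply]) hx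
        (by rw [hB.diag_eq_zero, zero_mul])]
    · ring
    · intro s
      simp only [hB.quadForm_insert_update hx, hC.quadForm_insert_update hx]
      ring

lemma IsHollowSymm.signMean_quadForm_mul_quadForm_mul_quadForm (hB : IsHollowSymm B)
    (hC : IsHollowSymm C) (hD : IsHollowSymm D) (T : Finset α) :
    signMean (fun s => quadForm T B s * quadForm T C s * quadForm T D s) =
      8 * ∑ x ∈ T, ∑ y ∈ T, ∑ z ∈ T, B x y * C y z * D z x := by
  induction T using Finset.induction_on with
  | empty => simp [quadForm_empty, signMean_const]
  | insert x T hx ih =>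
    rw [signMean_eq_of_average_update (G := fun s =>
      quadForm T B s * quadForm T C s * quadForm T D s +
        4 * (quadForm T C s * (linearForm T (B x) s * linearForm T (D x) s) +
          quadForm T D s * (linearForm T (B x) s * linearForm T (C x) s) +
          quadForm T B s * (linearForm T (D x) s * linearForm T (C x) s))) x]
    · simp only [signMean_add, signMean_const_mul, ih, hB.sum_sum_sum_insert hC hD hx,
        hB.signMean_quadForm_mul_linearForm_mul_linearForm,
        hC.signMean_quadForm_mul_linearForm_mul_linearForm,
        hD.signMean_quadForm_mul_linearForm_mul_linearForm]
      ring
    · intro s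
      simp only [hB.quadForm_insert_update hx, hC.quadForm_insert_update hx,
        hD.quadForm_insert_update hx]
      ring

lemma IsHollowSymm.signMean_quadForm_mul_add_linearForm_pow_four (hB : IsHollowSymm B)
    (T : Finset α) (w : α → ℝ) (a : ℝ) :
    signMean (fun s => quadForm T B s * (a + linearForm T w s) ^ 4) =
      ∑ x ∈ T, ∑ y ∈ T, B x y * (w x * w y *
        (12 * a ^ 2 + 12 * ∑ z ∈ T, w z ^ 2 - 8 * w x ^ 2 - 8 * w y ^ 2)) := by
  simp only [quadForm, sum_mul, signMean_sum, mul_assoc (B _ _), signMean_const_mul]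
  refine sum_congr rfl fun x hx => sum_congr rfl fun y hy => ?_
  obtain rfl | hxy := eq_or_ne x y
  · rw [hB.diag_eq_zero, zero_mul, zero_mul]
  · rw [signMean_eval_mul_eval_mul_add_linearForm_pow_four hx hy hxy]

end QuadForm

open SimpleGraph

section SignSum

variable {V : Type*}

lemma isHollowSymm_adjMatrix (G : SimpleGraph V) [DecidableRel G.Adj] :
    IsHollowSymm (G.adjMatrix ℝ) where
  symm := isSymm_adjMatrix G
  diag_eq_zero x := by simp

variable [DecidableEq V] {B : Matrix V V ℝ} {r : ℝ}

lemma linearForm_one_sq (T : Finset V) {s : V → ℝ} (hs : ∀ x, s x * s x = 1) :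
    linearForm T 1 s ^ 2 = #T + quadForm T ((⊤ : SimpleGraph V).adjMatrix ℝ) s := by
  have hterm (x y : V) : s x * s y =
      (if x = y then 1 else 0) + (⊤ : SimpleGraph V).adjMatrix ℝ x y * (s x * s y) := by
    by_cases h : x = y <;> simp [adjMatrix_apply, h, hs]
  calc linearForm T 1 s ^ 2 = ∑ x ∈ T, ∑ y ∈ T, s x * s y := by
        simp only [linearForm, Pi.one_apply, one_mul, sq, sum_mul_sum]
    _ = ∑ x ∈ T, ∑ y ∈ T,
          ((if x = y then 1 else 0) + (⊤ : SimpleGraph V).adjMatrix ℝ x y * (s x * s y)) :=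
        sum_congr rfl fun x _ => sum_congr rfl fun y _ => hterm x y
    _ = #T + quadForm T ((⊤ : SimpleGraph V).adjMatrix ℝ) s := by
        simp [sum_add_distrib, quadForm]

lemma IsHollowSymm.sum_adjMatrix_top_mul_mul (hB : IsHollowSymm B) {T : Finset V}
    (hr : ∀ x ∈ T, ∑ y ∈ T, B x y = r) :
    ∑ x ∈ T, ∑ y ∈ T, ∑ z ∈ T, (⊤ : SimpleGraph V).adjMatrix ℝ x y * B y z * B z x =
      r ^ 2 * #T - ∑ x ∈ T, ∑ y ∈ T, B x y ^ 2 := by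
  have hoff (x y z : V) : (⊤ : SimpleGraph V).adjMatrix ℝ x y * B y z * B z x =
      B z x * B z y - if x = y then B z x * B z y else 0 := by
    by_cases h : x = y
    · simp [h]
    · simp [adjMatrix_apply, h, hB.symm.apply z y, mul_comm]
  have hdiag (x : V) (hx : x ∈ T) :
      ∑ y ∈ T, ∑ z ∈ T, (if x = y then B z x * B z y else 0) = ∑ z ∈ T, B x z ^ 2 := by
    rw [sum_comm]
    exact sum_congr rfl fun z _ => by rw [sum_ite_eq T x, if_pos hx, hB.symm.apply, sq]
  have hrow (z : V) (hz : z ∈ T) : ∑ x ∈ T, ∑ y ∈ T, B z x * B z y = r ^ 2 := by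
    rw [← sum_mul_sum, hr z hz, sq]
  have hall : ∑ x ∈ T, ∑ y ∈ T, ∑ z ∈ T, B z x * B z y = r ^ 2 * #T := by
    calc ∑ x ∈ T, ∑ y ∈ T, ∑ z ∈ T, B z x * B z y
        = ∑ x ∈ T, ∑ z ∈ T, ∑ y ∈ T, B z x * B z y := sum_congr rfl fun _ _ => sum_comm
      _ = ∑ z ∈ T, ∑ x ∈ T, ∑ y ∈ T, B z x * B z y := sum_comm
      _ = r ^ 2 * #T := by rw [sum_congr rfl hrow, sum_const, nsmul_eq_mul, mul_comm]
  simp only [hoff, sum_sub_distrib, hall, sum_congr rfl hdiag]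

variable [Fintype V]

lemma signMean_linearForm_one_pow_two (T : Finset V) :
    signMean (fun s => linearForm T 1 s ^ 2) = #T := by
  simpa using signMean_add_linearForm_pow_two T 1 0

lemma signMean_linearForm_one_pow_four (T : Finset V) :
    signMean (fun s => linearForm T 1 s ^ 4) = 3 * (#T : ℝ) ^ 2 - 2 * #T := by
  simpa using signMean_add_linearForm_pow_four T 1 0

lemma signMean_linearForm_one_pow_six (T : Finset V) :
    signMean (fun s => linearForm T 1 s ^ 6) =
      15 * (#T : ℝ) ^ 3 - 30 * (#T : ℝ) ^ 2 + 16 * #T := by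
  simpa [sq, mul_assoc] using signMean_add_linearForm_pow_six T 1 0

lemma IsHollowSymm.signMean_linearForm_one_sq_mul_quadForm (hB : IsHollowSymm B) (T : Finset V) :
    signMean (fun s => linearForm T 1 s ^ 2 * quadForm T B s) =
      2 * ∑ x ∈ T, ∑ y ∈ T, B x y := by
  have h := hB.signMean_quadForm_mul_linearForm_mul_linearForm T 1 1
  simp only [Pi.one_apply, mul_one] at h
  rw [← h]
  exact signMean_congr fun s _ => by ring

lemma IsHollowSymm.signMean_linearForm_one_pow_four_mul_quadForm (hB : IsHollowSymm B)
    (T : Finset V) :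
    signMean (fun s => linearForm T 1 s ^ 4 * quadForm T B s) =
      (12 * #T - 16) * ∑ x ∈ T, ∑ y ∈ T, B x y := by
  have h := hB.signMean_quadForm_mul_add_linearForm_pow_four T 1 0
  simp only [zero_add, Pi.one_apply, one_pow, sum_const, nsmul_eq_mul, ← sum_mul] at h
  simp only [mul_comm (linearForm T 1 _ ^ 4), h]
  ring

lemma IsHollowSymm.signMean_linearForm_one_sq_mul_quadForm_sq (hB : IsHollowSymm B) {T : Finset V}
    (hr : ∀ x ∈ T, ∑ y ∈ T, B x y = r) :
    signMean (fun s => linearForm T 1 s ^ 2 * quadForm T B s ^ 2) =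
      8 * r ^ 2 * #T + (2 * #T - 8) * ∑ x ∈ T, ∑ y ∈ T, B x y ^ 2 := by
  set J := (⊤ : SimpleGraph V).adjMatrix ℝ
  calc signMean (fun s => linearForm T 1 s ^ 2 * quadForm T B s ^ 2)
      = signMean fun s => #T * (quadForm T B s * quadForm T B s) +
          quadForm T J s * quadForm T B s * quadForm T B s :=
        signMean_congr fun s hs => by rw [linearForm_one_sq T hs]; ring
    _ = #T * (2 * ∑ x ∈ T, ∑ y ∈ T, B x y ^ 2) +
          8 * (r ^ 2 * #T - ∑ x ∈ T, ∑ y ∈ T, B x y ^ 2) := by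
        rw [signMean_add, signMean_const_mul, hB.signMean_quadForm_mul_quadForm hB,
          (isHollowSymm_adjMatrix _).signMean_quadForm_mul_quadForm_mul_quadForm hB hB,
          hB.sum_adjMatrix_top_mul_mul hr]
        simp only [sq]
    _ = 8 * r ^ 2 * #T + (2 * #T - 8) * ∑ x ∈ T, ∑ y ∈ T, B x y ^ 2 := by ring

end SignSum

section Codegree

open scoped Matrix

variable {V : Type*} [Fintype V] {G : SimpleGraph V} [DecidableRel G.Adj] {T U : Finset V} {d : ℕ}
  {x y : V}

lemma sum_adjMatrix_mul_of_isBipartiteWith (hG : G.IsBipartiteWith T U) (hx : x ∈ T)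
    (f : V → ℝ) : ∑ y ∈ U, G.adjMatrix ℝ x y * f y = ∑ y, G.adjMatrix ℝ x y * f y := by
  refine sum_subset (subset_univ U) fun y _ hy => ?_
  rw [adjMatrix_apply, if_neg fun h => hy (hG.mem_of_mem_adj hx h), zero_mul]

lemma sum_adjMatrix_of_isBipartiteWith (hG : G.IsBipartiteWith T U) (hd : G.IsRegularOfDegree d)
    (hx : x ∈ T) : ∑ y ∈ U, G.adjMatrix ℝ x y = d := by
  have h := sum_adjMatrix_mul_of_isBipartiteWith hG hx fun _ => 1
  simp only [mul_one] at h
  rw [h, ← hd.degree_eq x, ← card_neighborFinset_eq_degree, neighborFinset_eq_filter]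
  simp only [adjMatrix_apply, sum_boole]

variable [DecidableEq V]

variable (G) in
/-- The matrix of codegrees: off the diagonal it counts the common neighbours of two vertices,
and its diagonal is zero. -/
def codegreeMatrix : Matrix V V ℝ := G.adjMatrix ℝ ^ 2 - G.degMatrix ℝ

lemma isHollowSymm_codegreeMatrix : IsHollowSymm (codegreeMatrix G) where
  symm := ((isSymm_adjMatrix G).pow 2).sub (isSymm_degMatrix ℝ G)
  diag_eq_zero x := by
    rw [codegreeMatrix, sq, Matrix.sub_apply, adjMatrix_mul_self_apply_self, degMatrix,
      Matrix.diagonal_apply_eq, sub_self]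

lemma codegreeMatrix_eq_sub_smul (hd : G.IsRegularOfDegree d) :
    codegreeMatrix G = G.adjMatrix ℝ ^ 2 - (d : ℝ) • 1 := by
  rw [codegreeMatrix, degMatrix, Matrix.smul_one_eq_diagonal]
  simp only [hd.degree_eq]

lemma codegreeMatrix_sq (hd : G.IsRegularOfDegree d) :
    codegreeMatrix G ^ 2 =
      G.adjMatrix ℝ ^ 4 - (2 * d : ℝ) • G.adjMatrix ℝ ^ 2 + (d ^ 2 : ℝ) • 1 := by
  rw [codegreeMatrix_eq_sub_smul hd]
  noncomm_ring
  module

lemma codegreeMatrix_cube (hd : G.IsRegularOfDegree d) :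
    codegreeMatrix G ^ 3 = G.adjMatrix ℝ ^ 6 - (3 * d : ℝ) • G.adjMatrix ℝ ^ 4 +
      (3 * d ^ 2 : ℝ) • G.adjMatrix ℝ ^ 2 - (d ^ 3 : ℝ) • 1 := by
  rw [codegreeMatrix_eq_sub_smul hd]
  noncomm_ring
  module

lemma adjMatrix_sq_apply_self (hd : G.IsRegularOfDegree d) (x : V) :
    (G.adjMatrix ℝ ^ 2) x x = d := by
  rw [sq, adjMatrix_mul_self_apply_self, hd.degree_eq]

lemma codegreeMatrix_eq_zero (hG : G.IsBipartiteWith T U) (hx : x ∈ T) (hy : y ∉ T) :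
    codegreeMatrix G x y = 0 := by
  have hsq : (G.adjMatrix ℝ ^ 2) x y = 0 := by
    rw [sq, adjMatrix_mul_apply]
    refine sum_eq_zero fun z hz => if_neg fun hzy => hy ?_
    exact hG.symm.mem_of_mem_adj (hG.mem_of_mem_adj hx ((mem_neighborFinset ..).1 hz)) hzy
  rw [codegreeMatrix, Matrix.sub_apply, hsq, degMatrix,
    Matrix.diagonal_apply_ne _ (ne_of_mem_of_not_mem hx hy), sub_zero]

lemma sum_adjMatrix_mul_adjMatrix (hG : G.IsBipartiteWith T U) (hd : G.IsRegularOfDegree d)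
    (hx : x ∈ T) (y : V) :
    ∑ z ∈ U, G.adjMatrix ℝ z x * G.adjMatrix ℝ z y =
      codegreeMatrix G x y + if x = y then (d : ℝ) else 0 := by
  calc ∑ z ∈ U, G.adjMatrix ℝ z x * G.adjMatrix ℝ z y
      = (G.adjMatrix ℝ ^ 2) x y := by
        simp only [(isSymm_adjMatrix G).apply x]
        rw [sum_adjMatrix_mul_of_isBipartiteWith hG hx, sq, Matrix.mul_apply]
    _ = _ := by simp [codegreeMatrix_eq_sub_smul hd, Matrix.one_apply]

lemma sum_codegreeMatrix_mul (hG : G.IsBipartiteWith T U) (hx : x ∈ T) (f : V → ℝ) :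
    ∑ y ∈ T, codegreeMatrix G x y * f y = ∑ y, codegreeMatrix G x y * f y :=
  sum_subset (subset_univ T) fun y _ hy => by rw [codegreeMatrix_eq_zero hG hx hy, zero_mul]

lemma sum_codegreeMatrix (hG : G.IsBipartiteWith T U) (hd : G.IsRegularOfDegree d) (hx : x ∈ T) :
    ∑ y ∈ T, codegreeMatrix G x y = d ^ 2 - d := by
  have hA : G.adjMatrix ℝ *ᵥ 1 = (d : ℝ) • 1 := by
    ext y
    simp [hd.degree_eq]
  have hC : codegreeMatrix G *ᵥ 1 = ((d : ℝ) ^ 2 - d) • 1 := by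
    rw [codegreeMatrix_eq_sub_smul hd, Matrix.sub_mulVec, sq, ← Matrix.mulVec_mulVec, hA,
      Matrix.mulVec_smul, hA, Matrix.smul_mulVec, Matrix.one_mulVec, smul_smul, ← sq, sub_smul]
  have hrow := sum_codegreeMatrix_mul hG hx 1
  rw [← dotProduct, ← Matrix.mulVec, hC] at hrow
  simpa using hrow

lemma sum_codegreeMatrix_sq (hG : G.IsBipartiteWith T U) (hd : G.IsRegularOfDegree d) (hx : x ∈ T)
    (h4 : (G.adjMatrix ℝ ^ 4) x x = 3 * d ^ 2 - 2 * d) :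
    ∑ y ∈ T, codegreeMatrix G x y ^ 2 = 2 * d ^ 2 - 2 * d := by
  calc ∑ y ∈ T, codegreeMatrix G x y ^ 2
      = ∑ y ∈ T, codegreeMatrix G x y * codegreeMatrix G y x :=
        sum_congr rfl fun y _ => by rw [isHollowSymm_codegreeMatrix.symm.apply, sq]
    _ = (codegreeMatrix G ^ 2) x x := by rw [sum_codegreeMatrix_mul hG hx, sq, Matrix.mul_apply]
    _ = 2 * d ^ 2 - 2 * d := by
        rw [codegreeMatrix_sq hd]
        simp only [Matrix.add_apply, Matrix.sub_apply, Matrix.smul_apply, Matrix.one_apply_eq,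
          smul_eq_mul, h4, adjMatrix_sq_apply_self hd]
        ring

lemma sum_codegreeMatrix_triangle (hG : G.IsBipartiteWith T U) (hd : G.IsRegularOfDegree d)
    (hx : x ∈ T) (h4 : (G.adjMatrix ℝ ^ 4) x x = 3 * d ^ 2 - 2 * d)
    (h6 : (G.adjMatrix ℝ ^ 6) x x = 15 * d ^ 3 - 30 * d ^ 2 + 16 * d) :
    ∑ y ∈ T, ∑ z ∈ T, codegreeMatrix G x y * codegreeMatrix G y z * codegreeMatrix G z x =
      8 * d ^ 3 - 24 * d ^ 2 + 16 * d := by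
  calc ∑ y ∈ T, ∑ z ∈ T, codegreeMatrix G x y * codegreeMatrix G y z * codegreeMatrix G z x
      = ∑ y ∈ T, codegreeMatrix G x y * (codegreeMatrix G ^ 2) y x :=
        sum_congr rfl fun y hy => by
          rw [sq, Matrix.mul_apply, ← sum_codegreeMatrix_mul hG hy, mul_sum]
          simp only [mul_assoc]
    _ = (codegreeMatrix G ^ 3) x x := by
        rw [sum_codegreeMatrix_mul hG hx, pow_succ' _ 2, Matrix.mul_apply]
    _ = 8 * d ^ 3 - 24 * d ^ 2 + 16 * d := by
        rw [codegreeMatrix_cube hd]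
        simp only [Matrix.add_apply, Matrix.sub_apply, Matrix.smul_apply, Matrix.one_apply_eq,
          smul_eq_mul, h4, h6, adjMatrix_sq_apply_self hd]
        ring

end Codegree

section CoeffPowerSum

variable {V : Type*} {G : SimpleGraph V} [DecidableRel G.Adj] {T U : Finset V} {d : ℕ}

lemma adjMatrix_pow {k : ℕ} (hk : k ≠ 0) (x y : V) :
    G.adjMatrix ℝ x y ^ k = G.adjMatrix ℝ x y := by
  by_cases h : G.Adj x y <;> simp [adjMatrix_apply, h, hk]

variable [Fintype V]

lemma sum_adjMatrix_pow {k : ℕ} (hG : G.IsBipartiteWith T U) (hd : G.IsRegularOfDegree d) {y : V}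
    (hy : y ∈ U) (hk : k ≠ 0) : ∑ x ∈ T, G.adjMatrix ℝ y x ^ k = d := by
  simp only [adjMatrix_pow hk, sum_adjMatrix_of_isBipartiteWith hG.symm hd hy]

lemma mul_card_of_isBipartiteWith (hG : G.IsBipartiteWith T U) (hd : G.IsRegularOfDegree d) :
    (d : ℝ) * #T = #G.edgeFinset := by
  rw [← isBipartiteWith_sum_degrees_eq_card_edges hG, sum_congr rfl fun x _ => hd.degree_eq x,
    sum_const, smul_eq_mul, mul_comm, Nat.cast_mul]

lemma mul_card_of_isBipartiteWith' (hG : G.IsBipartiteWith T U) (hd : G.IsRegularOfDegree d) :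
    (d : ℝ) * #U = #G.edgeFinset :=
  mul_card_of_isBipartiteWith hG.symm hd

variable (G T U d) in
/-- The power sum `∑ y ∈ U, R y ^ k` of the coefficients `R y = d + ∑ x ∈ T, A y x * s x`. In a
`d`-regular graph with parts `T` and `U`, `R y` is the coefficient of `s y` in the number of edges
spanned by a random set, scaled by `4`. -/
noncomputable def coeffPowerSum (k : ℕ) (s : V → ℝ) : ℝ :=
  ∑ y ∈ U, (d + linearForm T (G.adjMatrix ℝ y) s) ^ k

lemma sum_linearForm_adjMatrix (hG : G.IsBipartiteWith T U) (hd : G.IsRegularOfDegree d)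
    (s : V → ℝ) : ∑ y ∈ U, linearForm T (G.adjMatrix ℝ y) s = d * linearForm T 1 s := by
  simp only [linearForm, Pi.one_apply, one_mul, mul_sum]
  rw [sum_comm]
  refine sum_congr rfl fun x hx => ?_
  rw [← sum_mul, ← sum_adjMatrix_of_isBipartiteWith hG hd hx]
  simp only [(isSymm_adjMatrix G).apply x]

variable [DecidableEq V]

lemma sum_linearForm_adjMatrix_sq (hG : G.IsBipartiteWith T U) (hd : G.IsRegularOfDegree d)
    {s : V → ℝ} (hs : ∀ x, s x * s x = 1) :
    ∑ y ∈ U, linearForm T (G.adjMatrix ℝ y) s ^ 2 =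
      d * #T + quadForm T (codegreeMatrix G) s := by
  calc ∑ y ∈ U, linearForm T (G.adjMatrix ℝ y) s ^ 2
      = ∑ y ∈ U, ∑ x ∈ T, ∑ z ∈ T, G.adjMatrix ℝ y x * G.adjMatrix ℝ y z * (s x * s z) := by
        simp only [linearForm, sq, sum_mul_sum, mul_mul_mul_comm]
    _ = ∑ x ∈ T, ∑ z ∈ T, (∑ y ∈ U, G.adjMatrix ℝ y x * G.adjMatrix ℝ y z) * (s x * s z) := by
        rw [sum_comm]
        refine sum_congr rfl fun x _ => ?_
        rw [sum_comm]
        simp only [sum_mul]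
    _ = ∑ x ∈ T, ∑ z ∈ T, (codegreeMatrix G x z * (s x * s z) + if x = z then (d : ℝ) else 0) :=
        sum_congr rfl fun x hx => sum_congr rfl fun z _ => by
          rw [sum_adjMatrix_mul_adjMatrix hG hd hx, add_mul, ite_mul, zero_mul]
          split_ifs with hxz
          · rw [← hxz, hs, mul_one (d : ℝ)]
          · rfl
    _ = d * #T + quadForm T (codegreeMatrix G) s := by
        simp only [sum_add_distrib, sum_ite_eq, quadForm]
        rw [sum_ite_of_true fun _ hx => hx, sum_const, nsmul_eq_mul]
        ring

lemma coeffPowerSum_two (hG : G.IsBipartiteWith T U) (hd : G.IsRegularOfDegree d) {s : V → ℝ}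
    (hs : ∀ x, s x * s x = 1) :
    coeffPowerSum G T U d 2 s = #G.edgeFinset * (d + 1) + 2 * d ^ 2 * linearForm T 1 s +
      quadForm T (codegreeMatrix G) s := by
  calc coeffPowerSum G T U d 2 s
      = ∑ y ∈ U, ((d : ℝ) ^ 2 + 2 * d * linearForm T (G.adjMatrix ℝ y) s +
          linearForm T (G.adjMatrix ℝ y) s ^ 2) :=
        sum_congr rfl fun y _ => add_sq ..
    _ = d * (d * #U) + 2 * d * (d * linearForm T 1 s) +
          (d * #T + quadForm T (codegreeMatrix G) s) := by
        rw [sum_add_distrib, sum_add_distrib, sum_const, nsmul_eq_mul, ← mul_sum,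
          sum_linearForm_adjMatrix hG hd, sum_linearForm_adjMatrix_sq hG hd hs]
        ring
    _ = _ := by
        rw [mul_card_of_isBipartiteWith hG hd, mul_card_of_isBipartiteWith' hG hd]
        ring

lemma signMean_coeffPowerSum_four (hG : G.IsBipartiteWith T U) (hd : G.IsRegularOfDegree d) :
    signMean (coeffPowerSum G T U d 4) = #G.edgeFinset * (d ^ 3 + 6 * d ^ 2 + 3 * d - 2) := by
  have hterm (y : V) (hy : y ∈ U) :
      signMean (fun s => (d + linearForm T (G.adjMatrix ℝ y) s) ^ 4) =
        d * (d ^ 3 + 6 * d ^ 2 + 3 * d - 2) := by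
    rw [signMean_add_linearForm_pow_four, sum_adjMatrix_pow hG hd hy two_ne_zero,
      sum_adjMatrix_pow hG hd hy four_ne_zero]
    ring
  unfold coeffPowerSum
  rw [signMean_sum, sum_congr rfl hterm, sum_const, nsmul_eq_mul,
    ← mul_card_of_isBipartiteWith' hG hd]
  ring

lemma signMean_coeffPowerSum_six (hG : G.IsBipartiteWith T U) (hd : G.IsRegularOfDegree d) :
    signMean (coeffPowerSum G T U d 6) = #G.edgeFinset *
      (d ^ 5 + 15 * d ^ 4 + 45 * d ^ 3 - 15 * d ^ 2 - 30 * d + 16) := by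
  have hterm (y : V) (hy : y ∈ U) :
      signMean (fun s => (d + linearForm T (G.adjMatrix ℝ y) s) ^ 6) =
        d * (d ^ 5 + 15 * d ^ 4 + 45 * d ^ 3 - 15 * d ^ 2 - 30 * d + 16) := by
    rw [signMean_add_linearForm_pow_six, sum_adjMatrix_pow hG hd hy two_ne_zero,
      sum_adjMatrix_pow hG hd hy four_ne_zero, sum_adjMatrix_pow hG hd hy (by norm_num)]
    ring
  unfold coeffPowerSum
  rw [signMean_sum, sum_congr rfl hterm, sum_const, nsmul_eq_mul,
    ← mul_card_of_isBipartiteWith' hG hd]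
  ring

lemma signMean_linearForm_one_mul_coeffPowerSum_four (hG : G.IsBipartiteWith T U)
    (hd : G.IsRegularOfDegree d) :
    signMean (fun s => linearForm T 1 s * coeffPowerSum G T U d 4 s) =
      #G.edgeFinset * (4 * d ^ 3 + 12 * d ^ 2 - 8 * d) := by
  have hterm (y : V) (hy : y ∈ U) (x : V) (hx : x ∈ T) :
      signMean (fun s => s x * (d + linearForm T (G.adjMatrix ℝ y) s) ^ 4) =
        G.adjMatrix ℝ y x * (4 * d ^ 3 + 12 * d ^ 2 - 8 * d) := by
    rw [signMean_eval_mul_add_linearForm_pow_four hx, sum_adjMatrix_pow hG hd hy two_ne_zero]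
    linear_combination -8 * (d : ℝ) * adjMatrix_pow (G := G) three_ne_zero y x
  have hsum (s : V → ℝ) : linearForm T 1 s * coeffPowerSum G T U d 4 s =
      ∑ y ∈ U, ∑ x ∈ T, s x * (d + linearForm T (G.adjMatrix ℝ y) s) ^ 4 := by
    simp only [coeffPowerSum, mul_sum, ← sum_mul, linearForm, Pi.one_apply, one_mul]
  simp only [hsum, signMean_sum]
  rw [sum_congr rfl fun y hy => (sum_congr rfl (hterm y hy)).trans (by
    rw [← sum_mul, sum_adjMatrix_of_isBipartiteWith hG.symm hd hy]), sum_const, nsmul_eq_mul,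
    ← mul_card_of_isBipartiteWith' hG hd]
  ring

lemma IsHollowSymm.signMean_quadForm_mul_coeffPowerSum_four {B : Matrix V V ℝ}
    (hB : IsHollowSymm B) (hG : G.IsBipartiteWith T U) (hd : G.IsRegularOfDegree d) :
    signMean (fun s => quadForm T B s * coeffPowerSum G T U d 4 s) =
      (12 * d ^ 2 + 12 * d - 16) * ∑ x ∈ T, ∑ z ∈ T, B x z * codegreeMatrix G x z := by
  have hterm (y : V) (hy : y ∈ U) :
      signMean (fun s => quadForm T B s * (d + linearForm T (G.adjMatrix ℝ y) s) ^ 4) =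
        (12 * d ^ 2 + 12 * d - 16) *
          ∑ x ∈ T, ∑ z ∈ T, B x z * (G.adjMatrix ℝ y x * G.adjMatrix ℝ y z) := by
    simp only [hB.signMean_quadForm_mul_add_linearForm_pow_four,
      sum_adjMatrix_pow hG hd hy two_ne_zero, mul_sum]
    refine sum_congr rfl fun x _ => sum_congr rfl fun z _ => ?_
    have hx := adjMatrix_pow (G := G) three_ne_zero y x
    have hz := adjMatrix_pow (G := G) three_ne_zero y z
    linear_combination (-8 * B x z * G.adjMatrix ℝ y z) * hx + (-8 * B x z * G.adjMatrix ℝ y x) * hz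
  have hcodegree (x : V) (hx : x ∈ T) (z : V) :
      ∑ y ∈ U, B x z * (G.adjMatrix ℝ y x * G.adjMatrix ℝ y z) = B x z * codegreeMatrix G x z := by
    rw [← mul_sum, sum_adjMatrix_mul_adjMatrix hG hd hx, mul_add]
    split_ifs with hxz
    · rw [← hxz, hB.diag_eq_zero, zero_mul, zero_mul, add_zero]
    · rw [mul_zero, add_zero]
  simp only [coeffPowerSum, mul_sum, signMean_sum]
  rw [sum_congr rfl hterm, ← mul_sum, sum_comm, mul_sum]
  refine sum_congr rfl fun x hx => ?_
  rw [sum_comm, mul_sum]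
  exact sum_congr rfl fun z _ => by rw [hcodegree x hx]

end CoeffPowerSum

section EdgeForm

variable {V : Type*} {G : SimpleGraph V} [DecidableRel G.Adj] {T U : Finset V} {d : ℕ}

variable (G T U d) in
/-- The centred number of edges of a `d`-regular graph with parts `T` and `U` that are spanned by
a random set with signs `s`, scaled by `4`. It is written as a linear form in the signs on `U`
whose coefficients depend on the signs on `T`. -/
noncomputable def edgeForm (s : V → ℝ) : ℝ :=
  d * linearForm T 1 s + linearForm U (fun y => d + linearForm T (G.adjMatrix ℝ y) s) s

variable [Fintype V] [DecidableEq V]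

lemma signMean_edgeForm_pow (hTU : Disjoint T U) (k : ℕ) :
    signMean (fun s => edgeForm G T U d s ^ k) = signMean fun s => signMean fun t =>
      (d * linearForm T 1 s +
        linearForm U (fun y => d + linearForm T (G.adjMatrix ℝ y) s) t) ^ k := by
  rw [← signMean_piecewise _ T]
  have hT (w s t : V → ℝ) : linearForm T w (T.piecewise s t) = linearForm T w s :=
    linearForm_congr fun _ hx => piecewise_eq_of_mem _ _ _ hx
  have hU (w s t : V → ℝ) : linearForm U w (T.piecewise s t) = linearForm U w t :=
    linearForm_congr fun _ hx => piecewise_eq_of_notMem _ _ _ (disjoint_right.1 hTU hx)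
  simp only [edgeForm, hT, hU]

lemma signMean_linearForm_pow_mul_quadForm_pow_eq_zero {j : ℕ} (hj : Odd j) (T : Finset V)
    (w : V → ℝ) (B : Matrix V V ℝ) (k : ℕ) :
    signMean (fun s => linearForm T w s ^ j * quadForm T B s ^ k) = 0 :=
  signMean_eq_zero_of_odd fun s => by rw [linearForm_neg, quadForm_neg, hj.neg_pow, neg_mul]

lemma signMean_linearForm_pow_eq_zero {j : ℕ} (hj : Odd j) (T : Finset V) (w : V → ℝ) :
    signMean (fun s => linearForm T w s ^ j) = 0 :=
  signMean_eq_zero_of_odd fun s => by rw [linearForm_neg, hj.neg_pow]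

lemma signMean_edgeForm (hTU : Disjoint T U) : signMean (edgeForm G T U d) = 0 := by
  have hodd (T : Finset V) (w : V → ℝ) : signMean (linearForm T w) = 0 := by
    simpa only [pow_one] using signMean_linearForm_pow_eq_zero odd_one T w
  have h := signMean_edgeForm_pow (G := G) (d := d) hTU 1
  simp only [pow_one, signMean_add, signMean_const, signMean_const_mul, hodd, mul_zero,
    add_zero] at h
  exact h

lemma sum_sum_codegreeMatrix (hG : G.IsBipartiteWith T U) (hd : G.IsRegularOfDegree d) :
    ∑ x ∈ T, ∑ y ∈ T, codegreeMatrix G x y = #T * ((d : ℝ) ^ 2 - d) := by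
  rw [sum_eq_card_nsmul fun x hx => sum_codegreeMatrix hG hd hx, nsmul_eq_mul]

lemma sum_sum_codegreeMatrix_sq (hG : G.IsBipartiteWith T U) (hd : G.IsRegularOfDegree d)
    (h4 : ∀ x ∈ T, (G.adjMatrix ℝ ^ 4) x x = 3 * d ^ 2 - 2 * d) :
    ∑ x ∈ T, ∑ y ∈ T, codegreeMatrix G x y ^ 2 = #T * (2 * (d : ℝ) ^ 2 - 2 * d) := by
  rw [sum_eq_card_nsmul fun x hx => sum_codegreeMatrix_sq hG hd hx (h4 x hx), nsmul_eq_mul]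

lemma signMean_quadForm_codegreeMatrix_sq (hG : G.IsBipartiteWith T U)
    (hd : G.IsRegularOfDegree d)
    (h4 : ∀ x ∈ T, (G.adjMatrix ℝ ^ 4) x x = 3 * d ^ 2 - 2 * d) :
    signMean (fun s => quadForm T (codegreeMatrix G) s ^ 2) =
      #T * (4 * (d : ℝ) ^ 2 - 4 * d) := by
  have hC := isHollowSymm_codegreeMatrix (G := G)
  simp only [sq (quadForm _ _ _)]
  rw [hC.signMean_quadForm_mul_quadForm hC]
  simp only [← sq, sum_sum_codegreeMatrix_sq hG hd h4]
  ring

lemma signMean_quadForm_codegreeMatrix_cube (hG : G.IsBipartiteWith T U)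
    (hd : G.IsRegularOfDegree d)
    (h4 : ∀ x ∈ T, (G.adjMatrix ℝ ^ 4) x x = 3 * d ^ 2 - 2 * d)
    (h6 : ∀ x ∈ T, (G.adjMatrix ℝ ^ 6) x x = 15 * d ^ 3 - 30 * d ^ 2 + 16 * d) :
    signMean (fun s => quadForm T (codegreeMatrix G) s ^ 3) =
      #T * (64 * (d : ℝ) ^ 3 - 192 * d ^ 2 + 128 * d) := by
  have hC := isHollowSymm_codegreeMatrix (G := G)
  simp only [pow_three' (quadForm _ _ _)]
  rw [hC.signMean_quadForm_mul_quadForm_mul_quadForm hC hC,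
    sum_eq_card_nsmul fun x hx => sum_codegreeMatrix_triangle hG hd hx (h4 x hx) (h6 x hx),
    nsmul_eq_mul]
  ring

lemma signMean_coeffPowerSum_two (hG : G.IsBipartiteWith T U) (hd : G.IsRegularOfDegree d) :
    signMean (coeffPowerSum G T U d 2) = #G.edgeFinset * (d + 1) := by
  have hL := signMean_linearForm_pow_eq_zero odd_one T 1
  simp only [pow_one] at hL
  rw [signMean_congr fun s hs => coeffPowerSum_two hG hd hs]
  simp only [signMean_add, signMean_const, signMean_const_mul, hL,
    isHollowSymm_codegreeMatrix.signMean_quadForm]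
  ring

lemma signMean_linearForm_one_mul_coeffPowerSum_two (hG : G.IsBipartiteWith T U)
    (hd : G.IsRegularOfDegree d) :
    signMean (fun s => linearForm T 1 s * coeffPowerSum G T U d 2 s) = 2 * d ^ 2 * #T := by
  set L := linearForm T 1
  set W := quadForm T (codegreeMatrix G)
  calc signMean (fun s => L s * coeffPowerSum G T U d 2 s)
      = signMean fun s => #G.edgeFinset * (d + 1) * L s ^ 1 + 2 * d ^ 2 * L s ^ 2 +
          L s ^ 1 * W s ^ 1 :=
        signMean_congr fun s hs => by rw [coeffPowerSum_two hG hd hs]; ring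
    _ = 2 * d ^ 2 * #T := by
        simp only [signMean_add, signMean_const_mul, L, W, signMean_linearForm_one_pow_two,
          signMean_linearForm_pow_eq_zero odd_one,
          signMean_linearForm_pow_mul_quadForm_pow_eq_zero odd_one]
        ring

lemma signMean_linearForm_one_sq_mul_coeffPowerSum_two (hG : G.IsBipartiteWith T U)
    (hd : G.IsRegularOfDegree d) :
    signMean (fun s => linearForm T 1 s ^ 2 * coeffPowerSum G T U d 2 s) =
      #G.edgeFinset * (d + 1) * #T + 2 * #T * (d ^ 2 - d) := by
  set L := linearForm T 1
  set W := quadForm T (codegreeMatrix G)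
  calc signMean (fun s => L s ^ 2 * coeffPowerSum G T U d 2 s)
      = signMean fun s => #G.edgeFinset * (d + 1) * L s ^ 2 + 2 * d ^ 2 * L s ^ 3 +
          L s ^ 2 * W s :=
        signMean_congr fun s hs => by rw [coeffPowerSum_two hG hd hs]; ring
    _ = _ := by
        simp only [signMean_add, signMean_const_mul, L, W, signMean_linearForm_one_pow_two,
          isHollowSymm_codegreeMatrix.signMean_linearForm_one_sq_mul_quadForm,
          sum_sum_codegreeMatrix hG hd,
          signMean_linearForm_pow_eq_zero (by decide : Odd 3)]
        ring

lemma signMean_linearForm_one_cube_mul_coeffPowerSum_two (hG : G.IsBipartiteWith T U)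
    (hd : G.IsRegularOfDegree d) :
    signMean (fun s => linearForm T 1 s ^ 3 * coeffPowerSum G T U d 2 s) =
      2 * d ^ 2 * (3 * #T ^ 2 - 2 * #T) := by
  set L := linearForm T 1
  set W := quadForm T (codegreeMatrix G)
  calc signMean (fun s => L s ^ 3 * coeffPowerSum G T U d 2 s)
      = signMean fun s => #G.edgeFinset * (d + 1) * L s ^ 3 + 2 * d ^ 2 * L s ^ 4 +
          L s ^ 3 * W s ^ 1 :=
        signMean_congr fun s hs => by rw [coeffPowerSum_two hG hd hs]; ring
    _ = _ := by
        simp only [signMean_add, signMean_const_mul, L, W, signMean_linearForm_one_pow_four,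
          signMean_linearForm_pow_eq_zero (by decide : Odd 3),
          signMean_linearForm_pow_mul_quadForm_pow_eq_zero (by decide : Odd 3)]
        ring

lemma signMean_linearForm_one_pow_four_mul_coeffPowerSum_two (hG : G.IsBipartiteWith T U)
    (hd : G.IsRegularOfDegree d) :
    signMean (fun s => linearForm T 1 s ^ 4 * coeffPowerSum G T U d 2 s) =
      #G.edgeFinset * (d + 1) * (3 * #T ^ 2 - 2 * #T) +
        (12 * #T - 16) * (#T * (d ^ 2 - d)) := by
  set L := linearForm T 1
  set W := quadForm T (codegreeMatrix G)
  calc signMean (fun s => L s ^ 4 * coeffPowerSum G T U d 2 s)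
      = signMean fun s => #G.edgeFinset * (d + 1) * L s ^ 4 + 2 * d ^ 2 * L s ^ 5 +
          L s ^ 4 * W s :=
        signMean_congr fun s hs => by rw [coeffPowerSum_two hG hd hs]; ring
    _ = _ := by
        simp only [signMean_add, signMean_const_mul, L, W, signMean_linearForm_one_pow_four,
          isHollowSymm_codegreeMatrix.signMean_linearForm_one_pow_four_mul_quadForm,
          sum_sum_codegreeMatrix hG hd, signMean_linearForm_pow_eq_zero (by decide : Odd 5)]
        ring

lemma signMean_coeffPowerSum_two_sq (hG : G.IsBipartiteWith T U) (hd : G.IsRegularOfDegree d)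
    (h4 : ∀ x ∈ T, (G.adjMatrix ℝ ^ 4) x x = 3 * d ^ 2 - 2 * d) :
    signMean (fun s => coeffPowerSum G T U d 2 s ^ 2) =
      (#G.edgeFinset * (d + 1)) ^ 2 + #T * (4 * d ^ 4 + 4 * d ^ 2 - 4 * d) := by
  set L := linearForm T 1
  set W := quadForm T (codegreeMatrix G)
  set P : ℝ := #G.edgeFinset * (d + 1)
  calc signMean (fun s => coeffPowerSum G T U d 2 s ^ 2)
      = signMean fun s => P ^ 2 + 4 * d ^ 4 * L s ^ 2 + W s ^ 2 + 4 * P * d ^ 2 * L s ^ 1 +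
          2 * P * W s + 4 * d ^ 2 * (L s ^ 1 * W s ^ 1) :=
        signMean_congr fun s hs => by rw [coeffPowerSum_two hG hd hs]; ring
    _ = _ := by
        simp only [signMean_add, signMean_const_mul, signMean_const, L, W,
          signMean_linearForm_one_pow_two, isHollowSymm_codegreeMatrix.signMean_quadForm,
          signMean_quadForm_codegreeMatrix_sq hG hd h4, signMean_linearForm_pow_eq_zero odd_one,
          signMean_linearForm_pow_mul_quadForm_pow_eq_zero odd_one]
        ring

lemma signMean_linearForm_one_mul_coeffPowerSum_two_sq (hG : G.IsBipartiteWith T U)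
    (hd : G.IsRegularOfDegree d) :
    signMean (fun s => linearForm T 1 s * coeffPowerSum G T U d 2 s ^ 2) =
      4 * d ^ 2 * (#G.edgeFinset * (d + 1) * #T + 2 * #T * (d ^ 2 - d)) := by
  set L := linearForm T 1
  set W := quadForm T (codegreeMatrix G)
  set P : ℝ := #G.edgeFinset * (d + 1)
  calc signMean (fun s => L s * coeffPowerSum G T U d 2 s ^ 2)
      = signMean fun s => P ^ 2 * L s ^ 1 + 4 * d ^ 4 * L s ^ 3 + L s ^ 1 * W s ^ 2 +
          4 * P * d ^ 2 * L s ^ 2 + 2 * P * (L s ^ 1 * W s ^ 1) +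
          4 * d ^ 2 * (L s ^ 2 * W s) :=
        signMean_congr fun s hs => by rw [coeffPowerSum_two hG hd hs]; ring
    _ = _ := by
        simp only [signMean_add, signMean_const_mul, L, W, signMean_linearForm_one_pow_two,
          isHollowSymm_codegreeMatrix.signMean_linearForm_one_sq_mul_quadForm,
          sum_sum_codegreeMatrix hG hd,
          signMean_linearForm_pow_eq_zero odd_one,
          signMean_linearForm_pow_eq_zero (by decide : Odd 3),
          signMean_linearForm_pow_mul_quadForm_pow_eq_zero odd_one]
        ring

lemma signMean_linearForm_one_sq_mul_coeffPowerSum_two_sq (hG : G.IsBipartiteWith T U)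
    (hd : G.IsRegularOfDegree d)
    (h4 : ∀ x ∈ T, (G.adjMatrix ℝ ^ 4) x x = 3 * d ^ 2 - 2 * d) :
    signMean (fun s => linearForm T 1 s ^ 2 * coeffPowerSum G T U d 2 s ^ 2) =
      (#G.edgeFinset * (d + 1)) ^ 2 * #T + 4 * d ^ 4 * (3 * #T ^ 2 - 2 * #T) +
        (8 * (d ^ 2 - d) ^ 2 * #T + (2 * #T - 8) * (#T * (2 * d ^ 2 - 2 * d))) +
        4 * (#G.edgeFinset * (d + 1)) * (#T * (d ^ 2 - d)) := by
  set L := linearForm T 1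
  set W := quadForm T (codegreeMatrix G)
  set P : ℝ := #G.edgeFinset * (d + 1)
  calc signMean (fun s => L s ^ 2 * coeffPowerSum G T U d 2 s ^ 2)
      = signMean fun s => P ^ 2 * L s ^ 2 + 4 * d ^ 4 * L s ^ 4 + L s ^ 2 * W s ^ 2 +
          4 * P * d ^ 2 * L s ^ 3 + 2 * P * (L s ^ 2 * W s) +
          4 * d ^ 2 * (L s ^ 3 * W s ^ 1) :=
        signMean_congr fun s hs => by rw [coeffPowerSum_two hG hd hs]; ring
    _ = _ := by
        simp only [signMean_add, signMean_const_mul, L, W, signMean_linearForm_one_pow_two,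
          signMean_linearForm_one_pow_four,
          isHollowSymm_codegreeMatrix.signMean_linearForm_one_sq_mul_quadForm,
          sum_sum_codegreeMatrix hG hd,
          isHollowSymm_codegreeMatrix.signMean_linearForm_one_sq_mul_quadForm_sq
            fun _ hx => sum_codegreeMatrix hG hd hx, sum_sum_codegreeMatrix_sq hG hd h4,
          signMean_linearForm_pow_eq_zero (by decide : Odd 3),
          signMean_linearForm_pow_mul_quadForm_pow_eq_zero (by decide : Odd 3)]
        ring

lemma signMean_coeffPowerSum_two_cube (hG : G.IsBipartiteWith T U) (hd : G.IsRegularOfDegree d)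
    (h4 : ∀ x ∈ T, (G.adjMatrix ℝ ^ 4) x x = 3 * d ^ 2 - 2 * d)
    (h6 : ∀ x ∈ T, (G.adjMatrix ℝ ^ 6) x x = 15 * d ^ 3 - 30 * d ^ 2 + 16 * d) :
    signMean (fun s => coeffPowerSum G T U d 2 s ^ 3) =
      (#G.edgeFinset * (d + 1)) ^ 3 +
        3 * (#G.edgeFinset * (d + 1)) * (#T * (4 * d ^ 4 + 4 * d ^ 2 - 4 * d)) +
        #T * (64 * d ^ 3 - 192 * d ^ 2 + 128 * d) + 24 * d ^ 4 * (#T * (d ^ 2 - d)) := by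
  set L := linearForm T 1
  set W := quadForm T (codegreeMatrix G)
  set P : ℝ := #G.edgeFinset * (d + 1)
  calc signMean (fun s => coeffPowerSum G T U d 2 s ^ 3)
      = signMean fun s => P ^ 3 + 12 * P * d ^ 4 * L s ^ 2 + 3 * P * W s ^ 2 + W s ^ 3 +
          12 * d ^ 4 * (L s ^ 2 * W s) + 3 * P ^ 2 * W s + 6 * P ^ 2 * d ^ 2 * L s ^ 1 +
          8 * d ^ 6 * L s ^ 3 + 12 * P * d ^ 2 * (L s ^ 1 * W s ^ 1) +
          6 * d ^ 2 * (L s ^ 1 * W s ^ 2) :=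
        signMean_congr fun s hs => by rw [coeffPowerSum_two hG hd hs]; ring
    _ = _ := by
        simp only [signMean_add, signMean_const_mul, signMean_const, L, W,
          signMean_linearForm_one_pow_two, isHollowSymm_codegreeMatrix.signMean_quadForm,
          isHollowSymm_codegreeMatrix.signMean_linearForm_one_sq_mul_quadForm,
          sum_sum_codegreeMatrix hG hd,
          signMean_quadForm_codegreeMatrix_sq hG hd h4,
          signMean_quadForm_codegreeMatrix_cube hG hd h4 h6,
          signMean_linearForm_pow_eq_zero odd_one,
          signMean_linearForm_pow_eq_zero (by decide : Odd 3),
          signMean_linearForm_pow_mul_quadForm_pow_eq_zero odd_one]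
        ring

lemma signMean_linearForm_one_sq_mul_coeffPowerSum_four (hG : G.IsBipartiteWith T U)
    (hd : G.IsRegularOfDegree d) :
    signMean (fun s => linearForm T 1 s ^ 2 * coeffPowerSum G T U d 4 s) =
      #T * (#G.edgeFinset * (d ^ 3 + 6 * d ^ 2 + 3 * d - 2)) +
        (12 * d ^ 2 + 12 * d - 16) * (#T * (d ^ 2 - d)) := by
  have hJ := isHollowSymm_adjMatrix (⊤ : SimpleGraph V)
  have hsum : ∑ x ∈ T, ∑ z ∈ T, (⊤ : SimpleGraph V).adjMatrix ℝ x z * codegreeMatrix G x z =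
      #T * ((d : ℝ) ^ 2 - d) := by
    rw [← sum_sum_codegreeMatrix hG hd]
    refine sum_congr rfl fun x _ => sum_congr rfl fun z _ => ?_
    by_cases h : x = z
    · rw [h, hJ.diag_eq_zero, isHollowSymm_codegreeMatrix.diag_eq_zero, zero_mul]
    · rw [adjMatrix_apply, if_pos ((top_adj ..).2 h), one_mul]
  rw [signMean_congr fun s hs => by rw [linearForm_one_sq T hs, add_mul], signMean_add,
    signMean_const_mul, signMean_coeffPowerSum_four hG hd,
    hJ.signMean_quadForm_mul_coeffPowerSum_four hG hd, hsum]

lemma signMean_coeffPowerSum_two_mul_coeffPowerSum_four (hG : G.IsBipartiteWith T U)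
    (hd : G.IsRegularOfDegree d)
    (h4 : ∀ x ∈ T, (G.adjMatrix ℝ ^ 4) x x = 3 * d ^ 2 - 2 * d) :
    signMean (fun s => coeffPowerSum G T U d 2 s * coeffPowerSum G T U d 4 s) =
      #G.edgeFinset * (d + 1) * (#G.edgeFinset * (d ^ 3 + 6 * d ^ 2 + 3 * d - 2)) +
        2 * d ^ 2 * (#G.edgeFinset * (4 * d ^ 3 + 12 * d ^ 2 - 8 * d)) +
        (12 * d ^ 2 + 12 * d - 16) * (#T * (2 * d ^ 2 - 2 * d)) := by
  have hC := isHollowSymm_codegreeMatrix (G := G)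
  rw [signMean_congr fun s hs => by
      rw [coeffPowerSum_two hG hd hs, add_mul, add_mul, mul_assoc (2 * (d : ℝ) ^ 2)],
    signMean_add, signMean_add, signMean_const_mul, signMean_const_mul,
    signMean_coeffPowerSum_four hG hd, signMean_linearForm_one_mul_coeffPowerSum_four hG hd,
    hC.signMean_quadForm_mul_coeffPowerSum_four hG hd]
  simp only [← sq (codegreeMatrix G _ _), sum_sum_codegreeMatrix_sq hG hd h4]

lemma signMean_edgeForm_pow_two (hG : G.IsBipartiteWith T U) (hd : G.IsRegularOfDegree d) :
    signMean (fun s => edgeForm G T U d s ^ 2) = #G.edgeFinset * (2 * d + 1) := by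
  set L := linearForm T 1
  calc signMean (fun s => edgeForm G T U d s ^ 2)
      = signMean fun s => d ^ 2 * L s ^ 2 + coeffPowerSum G T U d 2 s := by
        simp only [signMean_edgeForm_pow (disjoint_coe.1 hG.disjoint),
          signMean_add_linearForm_pow_two]
        exact signMean_congr fun s _ => by simp only [L, coeffPowerSum]; ring
    _ = _ := by
        simp only [signMean_add, signMean_const_mul, L, signMean_linearForm_one_pow_two]
        rw [signMean_coeffPowerSum_two hG hd, ← mul_card_of_isBipartiteWith hG hd]
        ring

lemma signMean_edgeForm_pow_three (hG : G.IsBipartiteWith T U) (hd : G.IsRegularOfDegree d) :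
    signMean (fun s => edgeForm G T U d s ^ 3) = 6 * d ^ 2 * #G.edgeFinset := by
  set L := linearForm T 1
  calc signMean (fun s => edgeForm G T U d s ^ 3)
      = signMean fun s => d ^ 3 * L s ^ 3 + 3 * d * (L s * coeffPowerSum G T U d 2 s) := by
        simp only [signMean_edgeForm_pow (disjoint_coe.1 hG.disjoint),
          signMean_add_linearForm_pow_three]
        exact signMean_congr fun s _ => by simp only [L, coeffPowerSum]; ring
    _ = _ := by
        simp only [signMean_add, signMean_const_mul, L,
          signMean_linearForm_pow_eq_zero (by decide : Odd 3),
          signMean_linearForm_one_mul_coeffPowerSum_two hG hd,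
          ← mul_card_of_isBipartiteWith hG hd]
        ring

lemma signMean_edgeForm_pow_four (hG : G.IsBipartiteWith T U) (hd : G.IsRegularOfDegree d)
    (h4 : ∀ x ∈ T, (G.adjMatrix ℝ ^ 4) x x = 3 * d ^ 2 - 2 * d) :
    signMean (fun s => edgeForm G T U d s ^ 4) = #G.edgeFinset *
      (12 * d ^ 2 * #G.edgeFinset + 12 * d * #G.edgeFinset + 20 * d ^ 3 + 3 * #G.edgeFinset -
        24 * d ^ 2 + 6 * d - 8) := by
  set L := linearForm T 1
  set Q : ℕ → (V → ℝ) → ℝ := coeffPowerSum G T U d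
  calc signMean (fun s => edgeForm G T U d s ^ 4)
      = signMean fun s => d ^ 4 * L s ^ 4 + 6 * d ^ 2 * (L s ^ 2 * Q 2 s) + 3 * Q 2 s ^ 2 +
          -2 * Q 4 s := by
        simp only [signMean_edgeForm_pow (disjoint_coe.1 hG.disjoint),
          signMean_add_linearForm_pow_four]
        exact signMean_congr fun s _ => by simp only [L, Q, coeffPowerSum]; ring
    _ = _ := by
        simp only [signMean_add, signMean_const_mul, L, Q, signMean_linearForm_one_pow_four,
          signMean_linearForm_one_sq_mul_coeffPowerSum_two hG hd,
          signMean_coeffPowerSum_two_sq hG hd h4, signMean_coeffPowerSum_four hG hd,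
          ← mul_card_of_isBipartiteWith hG hd]
        ring

lemma signMean_edgeForm_pow_five (hG : G.IsBipartiteWith T U) (hd : G.IsRegularOfDegree d) :
    signMean (fun s => edgeForm G T U d s ^ 5) = 10 * d ^ 2 * #G.edgeFinset *
      (12 * d * #G.edgeFinset + 6 * #G.edgeFinset + 4 * d ^ 2 - 24 * d + 8) := by
  set L := linearForm T 1
  set Q : ℕ → (V → ℝ) → ℝ := coeffPowerSum G T U d
  calc signMean (fun s => edgeForm G T U d s ^ 5)
      = signMean fun s => d ^ 5 * L s ^ 5 + 10 * d ^ 3 * (L s ^ 3 * Q 2 s) +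
          15 * d * (L s * Q 2 s ^ 2) + -10 * d * (L s * Q 4 s) := by
        simp only [signMean_edgeForm_pow (disjoint_coe.1 hG.disjoint),
          signMean_add_linearForm_pow_five]
        exact signMean_congr fun s _ => by simp only [L, Q, coeffPowerSum]; ring
    _ = _ := by
        simp only [signMean_add, signMean_const_mul, L, Q,
          signMean_linearForm_pow_eq_zero (by decide : Odd 5),
          signMean_linearForm_one_cube_mul_coeffPowerSum_two hG hd,
          signMean_linearForm_one_mul_coeffPowerSum_two_sq hG hd,
          signMean_linearForm_one_mul_coeffPowerSum_four hG hd,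
          ← mul_card_of_isBipartiteWith hG hd]
        ring

lemma signMean_edgeForm_pow_six (hG : G.IsBipartiteWith T U) (hd : G.IsRegularOfDegree d)
    (h4 : ∀ x ∈ T, (G.adjMatrix ℝ ^ 4) x x = 3 * d ^ 2 - 2 * d)
    (h6 : ∀ x ∈ T, (G.adjMatrix ℝ ^ 6) x x = 15 * d ^ 3 - 30 * d ^ 2 + 16 * d) :
    signMean (fun s => edgeForm G T U d s ^ 6) = #G.edgeFinset *
      (120 * d ^ 3 * #G.edgeFinset ^ 2 + 180 * d ^ 2 * #G.edgeFinset ^ 2 +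
        960 * d ^ 4 * #G.edgeFinset + 90 * d * #G.edgeFinset ^ 2 - 420 * d ^ 3 * #G.edgeFinset -
        448 * d ^ 5 + 15 * #G.edgeFinset ^ 2 - 180 * d ^ 2 * #G.edgeFinset - 1320 * d ^ 4 -
        150 * d * #G.edgeFinset + 960 * d ^ 3 - 120 * #G.edgeFinset + 960 * d ^ 2 - 1680 * d +
        1216) := by
  set L := linearForm T 1
  set Q : ℕ → (V → ℝ) → ℝ := coeffPowerSum G T U d
  calc signMean (fun s => edgeForm G T U d s ^ 6)
      = signMean fun s => d ^ 6 * L s ^ 6 + 15 * d ^ 4 * (L s ^ 4 * Q 2 s) +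
          45 * d ^ 2 * (L s ^ 2 * Q 2 s ^ 2) + -30 * d ^ 2 * (L s ^ 2 * Q 4 s) +
          15 * Q 2 s ^ 3 + -30 * (Q 2 s * Q 4 s) + 16 * Q 6 s := by
        simp only [signMean_edgeForm_pow (disjoint_coe.1 hG.disjoint),
          signMean_add_linearForm_pow_six]
        exact signMean_congr fun s _ => by simp only [L, Q, coeffPowerSum]; ring
    _ = _ := by
        simp only [signMean_add, signMean_const_mul, L, Q, signMean_linearForm_one_pow_six,
          signMean_linearForm_one_pow_four_mul_coeffPowerSum_two hG hd,
          signMean_linearForm_one_sq_mul_coeffPowerSum_two_sq hG hd h4,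
          signMean_linearForm_one_sq_mul_coeffPowerSum_four hG hd,
          signMean_coeffPowerSum_two_cube hG hd h4 h6,
          signMean_coeffPowerSum_two_mul_coeffPowerSum_four hG hd h4,
          signMean_coeffPowerSum_six hG hd, ← mul_card_of_isBipartiteWith hG hd]
        ring

end EdgeForm

section EdgeCount

variable {V : Type*} [Fintype V] {G : SimpleGraph V} [DecidableRel G.Adj]
  {T U : Finset V} {d : ℕ}

lemma sum_edgeFinset_of_isBipartiteWith (hG : G.IsBipartiteWith T U) (f : Sym2 V → ℝ) :
    ∑ e ∈ G.edgeFinset, f e = ∑ x ∈ T, ∑ y ∈ U, G.adjMatrix ℝ x y * f s(x, y) := by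
  simp only [adjMatrix_apply, ite_mul, one_mul, zero_mul]
  rw [← sum_product' (f := fun x y => if G.Adj x y then f s(x, y) else 0), ← sum_filter]
  refine (sum_nbij (fun p : V × V => s(p.1, p.2)) ?_ ?_ ?_ fun _ _ => rfl).symm
  · rintro ⟨x, y⟩ h
    exact mem_edgeFinset.2 (mem_filter.1 h).2
  · rintro ⟨x, y⟩ h ⟨z, w⟩ h' heq
    obtain ⟨rfl, rfl⟩ | ⟨rfl, rfl⟩ := Sym2.eq_iff.1 heq
    · rfl
    · have hx := (mem_product.1 (mem_filter.1 h).1).1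
      have hx' := (mem_product.1 (mem_filter.1 h').1).2
      exact absurd hx' (disjoint_left.1 (disjoint_coe.1 hG.disjoint) hx)
  · intro e he
    induction e with | _ x y
    have hxy : G.Adj x y := mem_edgeFinset.1 he
    obtain ⟨hx, hy⟩ | ⟨hx, hy⟩ := hG.mem_of_adj hxy
    · exact ⟨(x, y), mem_filter.2 ⟨mem_product.2 ⟨hx, hy⟩, hxy⟩, rfl⟩
    · exact ⟨(y, x), mem_filter.2 ⟨mem_product.2 ⟨hy, hx⟩, hxy.symm⟩, Sym2.eq_swap⟩

variable [DecidableEq V]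

lemma four_mul_card_edges_subset (hG : G.IsBipartiteWith T U) (hd : G.IsRegularOfDegree d)
    (S : Finset V) :
    4 * (#{e ∈ G.edgeFinset | e.toFinset ⊆ S} : ℝ) =
      #G.edgeFinset + edgeForm G T U d (memberSign S) := by
  set s := memberSign S
  have hindicator (x y : V) :
      4 * (if s(x, y).toFinset ⊆ S then 1 else 0) = (1 + s x) * (1 + s y) := by
    by_cases hx : x ∈ S <;> by_cases hy : y ∈ S <;>
      norm_num [s, memberSign, hx, hy, Sym2.toFinset_mk_eq, insert_subset_iff]
  have hrow (y : V) (hy : y ∈ U) :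
      ∑ x ∈ T, G.adjMatrix ℝ x y * ((1 + s x) * (1 + s y)) =
        d + linearForm T (G.adjMatrix ℝ y) s +
          (d + linearForm T (G.adjMatrix ℝ y) s) * s y := by
    simp only [← mul_assoc, ← sum_mul, (isSymm_adjMatrix G).apply y]
    simp only [mul_one_add, sum_add_distrib]
    rw [sum_adjMatrix_of_isBipartiteWith hG.symm hd hy, linearForm]
  calc 4 * (#{e ∈ G.edgeFinset | e.toFinset ⊆ S} : ℝ)
      = ∑ x ∈ T, ∑ y ∈ U, G.adjMatrix ℝ x y * ((1 + s x) * (1 + s y)) := by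
        rw [← sum_boole, sum_edgeFinset_of_isBipartiteWith hG, mul_sum]
        simp only [mul_sum, mul_left_comm (4 : ℝ), hindicator]
    _ = ∑ y ∈ U, (d + linearForm T (G.adjMatrix ℝ y) s +
          (d + linearForm T (G.adjMatrix ℝ y) s) * s y) := by
        rw [sum_comm]
        exact sum_congr rfl hrow
    _ = _ := by
        rw [sum_add_distrib, sum_add_distrib, sum_const, nsmul_eq_mul, mul_comm,
          mul_card_of_isBipartiteWith' hG hd, sum_linearForm_adjMatrix hG hd, edgeForm, linearForm,
          add_assoc]
        rfl

end EdgeCount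

section CubeGraph

variable {n : ℕ}

/-- The vertex obtained from `x` by changing its `i`-th coordinate. -/
def flipAt (i : Fin n) (x : Cube n) : Cube n := update x i (!x i)

lemma flipAt_flipAt (i : Fin n) (x : Cube n) : flipAt i (flipAt i x) = x := by
  simp [flipAt]

lemma flipAt_ne (i : Fin n) (x : Cube n) : flipAt i x ≠ x := fun h => by
  simpa [flipAt] using congrFun h i

lemma flipAt_injective_left (x : Cube n) : Injective fun i => flipAt i x := by
  intro i j h
  by_contra hij
  simpa [flipAt, hij] using congrFun h i

/-- The graph of the discrete cube: vertices are adjacent when they differ in exactly one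
coordinate. -/
def cubeGraph (n : ℕ) : SimpleGraph (Cube n) where
  Adj x y := ∃ i, flipAt i x = y
  symm := ⟨by
    rintro x _ ⟨i, rfl⟩
    exact ⟨i, flipAt_flipAt i x⟩⟩
  loopless := ⟨fun x ⟨i, h⟩ => flipAt_ne i x h⟩

instance : DecidableRel (cubeGraph n).Adj := fun x y =>
  inferInstanceAs (Decidable (∃ i, flipAt i x = y))

lemma neighborFinset_cubeGraph (x : Cube n) :
    (cubeGraph n).neighborFinset x = univ.image fun i => flipAt i x := by
  ext y
  simp only [mem_neighborFinset, mem_image, mem_univ, true_and]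
  rfl

lemma isRegularOfDegree_cubeGraph (n : ℕ) : (cubeGraph n).IsRegularOfDegree n := fun x => by
  rw [← card_neighborFinset_eq_degree, neighborFinset_cubeGraph,
    card_image_of_injective _ (flipAt_injective_left x), card_univ, Fintype.card_fin]

lemma sum_adjMatrix_cubeGraph_mul (x : Cube n) (f : Cube n → ℝ) :
    ∑ y, (cubeGraph n).adjMatrix ℝ x y * f y = ∑ i, f (flipAt i x) := by
  rw [← sum_image (f := f) (flipAt_injective_left x).injOn, ← neighborFinset_cubeGraph]
  exact adjMatrix_mulVec_apply ..

lemma card_edgeFinset_cubeGraph (n : ℕ) : (#(cubeGraph n).edgeFinset : ℝ) = n * 2 ^ n / 2 := by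
  have h := (cubeGraph n).sum_degrees_eq_twice_card_edges
  simp only [(isRegularOfDegree_cubeGraph n).degree_eq, sum_const, card_univ, Fintype.card_fun,
    Fintype.card_bool, Fintype.card_fin, smul_eq_mul] at h
  have h' : (2 : ℝ) ^ n * n = 2 * #(cubeGraph n).edgeFinset := by exact_mod_cast h
  linarith

/-- The Walsh character `∏ s i` over the coordinates `i` with `x i = true`. -/
def walsh {R : Type*} [CommMonoid R] (x : Cube n) (s : Fin n → R) : R :=
  ∏ i, if x i then s i else 1

lemma walsh_mul_self {R : Type*} [CommMonoid R] (x : Cube n) {s : Fin n → R}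
    (hs : ∀ i, s i * s i = 1) : walsh x s * walsh x s = 1 := by
  rw [walsh, ← prod_mul_distrib]
  refine prod_eq_one fun i _ => ?_
  split_ifs
  exacts [hs i, mul_one 1]

lemma walsh_flipAt {R : Type*} [CommMonoid R] (i : Fin n) (x : Cube n) {s : Fin n → R}
    (hs : ∀ i, s i * s i = 1) : walsh (flipAt i x) s = s i * walsh x s := by
  rw [walsh, walsh, Fintype.prod_eq_mul_prod_compl i, Fintype.prod_eq_mul_prod_compl i,
    ← mul_assoc]
  congr 1
  · cases h : x i <;> simp [flipAt, h, hs]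
  · refine prod_congr rfl fun j hj => ?_
    rw [flipAt, update_of_ne (by simpa using hj)]

lemma walsh_update_neg {R : Type*} [CommRing R] (i : Fin n) (x : Cube n) (s : Fin n → R) :
    walsh x (update s i (-s i)) = if x i then -walsh x s else walsh x s := by
  have hrest : ∏ j ∈ {i}ᶜ, (if x j then update s i (-s i) j else 1) =
      ∏ j ∈ {i}ᶜ, if x j then s j else 1 :=
    prod_congr rfl fun j hj => by rw [update_of_ne (by simpa using hj)]
  rw [walsh, walsh, Fintype.prod_eq_mul_prod_compl i, Fintype.prod_eq_mul_prod_compl i, hrest,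
    update_self]
  split_ifs <;> simp

lemma signMean_walsh_mul_walsh (x y : Cube n) :
    signMean (fun s => walsh x s * walsh y s) = if x = y then 1 else 0 := by
  split_ifs with h
  · rw [h, signMean_congr fun s hs => walsh_mul_self y hs, signMean_const]
  · obtain ⟨i, hi⟩ := ne_iff.1 h
    have hneg : signMean (fun s => -1 * (walsh x s * walsh y s)) =
        signMean fun s => walsh x s * walsh y s := by
      rw [← signMean_update_neg (fun s => walsh x s * walsh y s) i]
      refine signMean_congr fun s _ => ?_
      cases hx : x i <;> cases hy : y i <;> simp_all [walsh_update_neg]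
    rw [signMean_const_mul] at hneg
    linarith

-- The Walsh characters `x ↦ walsh x s` are eigenvectors of the cube, with eigenvalue `∑ i, s i`.
lemma adjMatrix_cubeGraph_pow_apply (k : ℕ) (x y : Cube n) :
    ((cubeGraph n).adjMatrix ℝ ^ k) x y =
      signMean fun s => linearForm univ 1 s ^ k * (walsh x s * walsh y s) := by
  induction k generalizing x with
  | zero => simp only [pow_zero, one_mul, signMean_walsh_mul_walsh, Matrix.one_apply]
  | succ k ih =>
    rw [pow_succ', Matrix.mul_apply, sum_adjMatrix_cubeGraph_mul]
    simp only [ih]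
    rw [← signMean_sum]
    refine signMean_congr fun s hs => ?_
    simp only [walsh_flipAt _ _ hs, ← mul_sum, mul_assoc, ← sum_mul]
    simp only [linearForm, Pi.one_apply, one_mul]
    ring

lemma adjMatrix_cubeGraph_pow_apply_self (k : ℕ) (x : Cube n) :
    ((cubeGraph n).adjMatrix ℝ ^ k) x x =
      signMean fun s : Fin n → ℝ => linearForm univ 1 s ^ k := by
  rw [adjMatrix_cubeGraph_pow_apply]
  exact signMean_congr fun s hs => by rw [walsh_mul_self x hs, mul_one]

lemma adjMatrix_cubeGraph_pow_four_apply_self (x : Cube n) :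
    ((cubeGraph n).adjMatrix ℝ ^ 4) x x = 3 * n ^ 2 - 2 * n := by
  rw [adjMatrix_cubeGraph_pow_apply_self, signMean_linearForm_one_pow_four, card_univ,
    Fintype.card_fin]

lemma adjMatrix_cubeGraph_pow_six_apply_self (x : Cube n) :
    ((cubeGraph n).adjMatrix ℝ ^ 6) x x = 15 * n ^ 3 - 30 * n ^ 2 + 16 * n := by
  rw [adjMatrix_cubeGraph_pow_apply_self, signMean_linearForm_one_pow_six, card_univ,
    Fintype.card_fin]

/-- The vertices with an even number of coordinates equal to `true`: one part of the bipartite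
graph `cubeGraph n`. -/
def evenVertices (n : ℕ) : Finset (Cube n) := {x | walsh x (-1 : Fin n → ℤˣ) = 1}

lemma flipAt_mem_evenVertices (i : Fin n) (x : Cube n) :
    flipAt i x ∈ evenVertices n ↔ x ∉ evenVertices n := by
  simp only [evenVertices, mem_filter_univ]
  rw [walsh_flipAt i x fun _ => Int.units_mul_self _, Pi.neg_apply, Pi.one_apply, neg_one_mul,
    neg_eq_iff_eq_neg, ← Int.units_ne_iff_eq_neg]

lemma isBipartiteWith_cubeGraph (n : ℕ) :
    (cubeGraph n).IsBipartiteWith (evenVertices n) ((evenVertices n)ᶜ : Finset (Cube n)) where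
  disjoint := disjoint_coe.2 disjoint_compl_right
  mem_of_adj := by
    rintro x _ ⟨i, rfl⟩
    simp only [mem_coe, mem_compl, flipAt_mem_evenVertices]
    tauto

end CubeGraph

section Subcubes

variable {n : ℕ}

lemma eq_or_eq_flipAt_iff {i : Fin n} {x a : Cube n} :
    x = a ∨ x = flipAt i a ↔ ∀ j, j ∉ ({i} : Finset (Fin n)) → x j = a j := by
  simp only [flipAt, eq_update_iff, mem_singleton]
  constructor
  · rintro (rfl | h) j hj
    exacts [rfl, h.2 j hj]
  · intro h
    obtain hi | hi := Bool.eq_or_eq_not (x i) (a i)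
    · exact .inl (funext fun j => if hj : j = i then hj ▸ hi else h j hj)
    · exact .inr ⟨hi, h⟩

lemma isSubcube_one_iff {C : Finset (Cube n)} :
    IsSubcube 1 C ↔ ∃ i a, C = {a, flipAt i a} := by
  have hpair (i : Fin n) (a : Cube n) : C = {a, flipAt i a} ↔
      ∀ x, x ∈ C ↔ ∀ j, j ∉ ({i} : Finset (Fin n)) → x j = a j := by
    rw [Finset.ext_iff]
    exact forall_congr' fun x => by rw [← eq_or_eq_flipAt_iff, mem_insert, mem_singleton]
  simp only [IsSubcube, hpair]
  constructor
  · rintro ⟨J, a, hJ, hC⟩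
    obtain ⟨i, rfl⟩ := card_eq_one.1 hJ
    exact ⟨i, a, hC⟩
  · rintro ⟨i, a, hC⟩
    exact ⟨{i}, a, card_singleton i, hC⟩

lemma subcubes_one (n : ℕ) : subcubes n 1 = (cubeGraph n).edgeFinset.image Sym2.toFinset := by
  ext C
  simp only [subcubes, mem_filter, mem_univ, true_and, isSubcube_one_iff, mem_image]
  constructor
  · rintro ⟨i, a, rfl⟩
    exact ⟨s(a, flipAt i a), mem_edgeFinset.2 ⟨i, rfl⟩, Sym2.toFinset_mk_eq⟩
  · rintro ⟨e, he, rfl⟩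
    induction e with | _ x y
    obtain ⟨i, rfl⟩ : ∃ i, flipAt i x = y := mem_edgeFinset.1 he
    exact ⟨i, x, Sym2.toFinset_mk_eq⟩

lemma sym2_toFinset_injective {α : Type*} [DecidableEq α] :
    Injective (Sym2.toFinset : Sym2 α → Finset α) := fun e f h =>
  Sym2.ext fun x => by rw [← Sym2.mem_toFinset, h, Sym2.mem_toFinset]

lemma numSubcubes_one_eq_card (S : Finset (Cube n)) :
    numSubcubes n 1 S = #{e ∈ (cubeGraph n).edgeFinset | e.toFinset ⊆ S} := by
  rw [numSubcubes, subcubes_one, filter_image, card_image_of_injective _ sym2_toFinset_injective]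

lemma numSubcubes_one_eq_edgeForm (S : Finset (Cube n)) :
    numSubcubes n 1 S = n * 2 ^ n / 8 +
      edgeForm (cubeGraph n) (evenVertices n) (evenVertices n)ᶜ n (memberSign S) / 4 := by
  have h := four_mul_card_edges_subset (isBipartiteWith_cubeGraph n)
    (isRegularOfDegree_cubeGraph n) S
  rw [← numSubcubes_one_eq_card, card_edgeFinset_cubeGraph] at h
  linarith

end Subcubes

section CentralMoments

open MeasureTheory ProbabilityTheory

variable {n : ℕ}

lemma integral_randomSubset_memberSign (F : (Cube n → ℝ) → ℝ) :
    ∫ S, F (memberSign S) ∂randomSubset n = signMean F := by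
  rw [randomSubset, PMF.integral_eq_sum, signMean, Fintype.expect_eq_sum_div_card]
  simp only [PMF.uniformOfFintype_apply, ENNReal.toReal_inv, ENNReal.toReal_natCast, smul_eq_mul,
    ← mul_sum]
  rw [inv_mul_eq_div]

lemma integral_numSubcubes_one (n : ℕ) :
    ∫ S, numSubcubes n 1 S ∂randomSubset n = n * 2 ^ n / 8 := by
  set Q : (Cube n → ℝ) → ℝ := edgeForm (cubeGraph n) (evenVertices n) (evenVertices n)ᶜ n
  have hmean : signMean Q = 0 := signMean_edgeForm disjoint_compl_right
  calc ∫ S, numSubcubes n 1 S ∂randomSubset n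
      = signMean fun s => n * 2 ^ n / 8 + 4⁻¹ * Q s := by
        rw [← integral_randomSubset_memberSign]
        simp only [numSubcubes_one_eq_edgeForm, inv_mul_eq_div, Q]
    _ = n * 2 ^ n / 8 := by
        rw [signMean_add, signMean_const, signMean_const_mul, hmean, mul_zero, add_zero]

lemma centralMoment_numSubcubes_one (n k : ℕ) :
    centralMoment (numSubcubes n 1) k (randomSubset n) = (4 ^ k)⁻¹ *
      signMean fun s =>
        edgeForm (cubeGraph n) (evenVertices n) (evenVertices n)ᶜ n s ^ k := by
  rw [← signMean_const_mul, ← integral_randomSubset_memberSign, centralMoment,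
    integral_numSubcubes_one]
  simp only [Pi.pow_apply, Pi.sub_apply, numSubcubes_one_eq_edgeForm, add_sub_cancel_left, div_pow,
    inv_mul_eq_div]

lemma variance_numSubcubes_one (n : ℕ) :
    variance (numSubcubes n 1) (randomSubset n) = n * 2 ^ n * (2 * n + 1) / 32 := by
  rw [← centralMoment_two_eq_variance .of_discrete, centralMoment_numSubcubes_one,
    signMean_edgeForm_pow_two (isBipartiteWith_cubeGraph n) (isRegularOfDegree_cubeGraph n),
    card_edgeFinset_cubeGraph]
  ring

lemma centralMoment_three_numSubcubes_one (n : ℕ) :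
    centralMoment (numSubcubes n 1) 3 (randomSubset n) = 3 * (n : ℝ) ^ 3 * 2 ^ n / 64 := by
  rw [centralMoment_numSubcubes_one, signMean_edgeForm_pow_three (isBipartiteWith_cubeGraph n)
    (isRegularOfDegree_cubeGraph n), card_edgeFinset_cubeGraph]
  ring

lemma centralMoment_four_numSubcubes_one (n : ℕ) :
    centralMoment (numSubcubes n 1) 4 (randomSubset n) =
      (n : ℝ) * 2 ^ n / 1024 *
        (12 * (n : ℝ) ^ 3 * 2 ^ n + 12 * (n : ℝ) ^ 2 * 2 ^ n + 40 * (n : ℝ) ^ 3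
          + 3 * (n : ℝ) * 2 ^ n - 48 * (n : ℝ) ^ 2 + 12 * (n : ℝ) - 16) := by
  rw [centralMoment_numSubcubes_one, signMean_edgeForm_pow_four (isBipartiteWith_cubeGraph n)
    (isRegularOfDegree_cubeGraph n) fun x _ => adjMatrix_cubeGraph_pow_four_apply_self x,
    card_edgeFinset_cubeGraph]
  ring

lemma centralMoment_five_numSubcubes_one (n : ℕ) :
    centralMoment (numSubcubes n 1) 5 (randomSubset n) =
      5 * (n : ℝ) ^ 3 * 2 ^ n / 1024 *
        (6 * (n : ℝ) ^ 2 * 2 ^ n + 3 * (n : ℝ) * 2 ^ n + 4 * (n : ℝ) ^ 2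
          - 24 * (n : ℝ) + 8) := by
  rw [centralMoment_numSubcubes_one, signMean_edgeForm_pow_five (isBipartiteWith_cubeGraph n)
    (isRegularOfDegree_cubeGraph n), card_edgeFinset_cubeGraph]
  ring

lemma centralMoment_six_numSubcubes_one (n : ℕ) :
    centralMoment (numSubcubes n 1) 6 (randomSubset n) =
      (n : ℝ) * 2 ^ n / 32768 *
        (120 * (n : ℝ) ^ 5 * (2 ^ n) ^ 2 + 180 * (n : ℝ) ^ 4 * (2 ^ n) ^ 2
          + 1920 * (n : ℝ) ^ 5 * 2 ^ n + 90 * (n : ℝ) ^ 3 * (2 ^ n) ^ 2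
          - 840 * (n : ℝ) ^ 4 * 2 ^ n - 1792 * (n : ℝ) ^ 5
          + 15 * (n : ℝ) ^ 2 * (2 ^ n) ^ 2 - 360 * (n : ℝ) ^ 3 * 2 ^ n
          - 5280 * (n : ℝ) ^ 4 - 300 * (n : ℝ) ^ 2 * 2 ^ n + 3840 * (n : ℝ) ^ 3
          - 240 * (n : ℝ) * 2 ^ n + 3840 * (n : ℝ) ^ 2 - 6720 * (n : ℝ) + 4864) := by
  rw [centralMoment_numSubcubes_one, signMean_edgeForm_pow_six (isBipartiteWith_cubeGraph n)
    (isRegularOfDegree_cubeGraph n) (fun x _ => adjMatrix_cubeGraph_pow_four_apply_self x)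
    fun x _ => adjMatrix_cubeGraph_pow_six_apply_self x, card_edgeFinset_cubeGraph]
  ring

end CentralMoments

section Limits

open MeasureTheory ProbabilityTheory Filter Topology

lemma scaledCentralMoment_eq_div (n r k : ℕ) :
    scaledCentralMoment n r k = centralMoment (numSubcubes n r) k (randomSubset n) /
      √(variance (numSubcubes n r) (randomSubset n)) ^ k := by
  simp only [scaledCentralMoment, centralMoment, div_pow, Pi.pow_apply, Pi.sub_apply]
  exact integral_div _ _

lemma scaledCentralMoment_two_mul (n r k : ℕ) :
    scaledCentralMoment n r (2 * k) = centralMoment (numSubcubes n r) (2 * k) (randomSubset n) /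
      variance (numSubcubes n r) (randomSubset n) ^ k := by
  rw [scaledCentralMoment_eq_div, pow_mul, Real.sq_sqrt (variance_nonneg _ _)]

lemma scaledCentralMoment_sq (n r k : ℕ) :
    scaledCentralMoment n r k ^ 2 = centralMoment (numSubcubes n r) k (randomSubset n) ^ 2 /
      variance (numSubcubes n r) (randomSubset n) ^ k := by
  rw [scaledCentralMoment_eq_div, div_pow, pow_right_comm, Real.sq_sqrt (variance_nonneg _ _)]

lemma tendsto_of_eq_inv_natCast_inv_two_pow {u : ℕ → ℝ} {g : ℝ × ℝ → ℝ}
    (hg : ContinuousAt g (0, 0)) (hu : ∀ n : ℕ, n ≠ 0 → u n = g ((n : ℝ)⁻¹, (2 ^ n)⁻¹)) :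
    Tendsto u atTop (𝓝 (g (0, 0))) := by
  have hinv : Tendsto (fun n : ℕ => (n : ℝ)⁻¹) atTop (𝓝 0) := tendsto_inv_atTop_nhds_zero_nat
  have hpow : Tendsto (fun n : ℕ => ((2 : ℝ) ^ n)⁻¹) atTop (𝓝 0) :=
    (tendsto_pow_atTop_atTop_of_one_lt one_lt_two).inv_tendsto_atTop
  refine (hg.tendsto.comp (hinv.prodMk_nhds hpow)).congr' ?_
  filter_upwards [eventually_ne_atTop 0] with n hn using (hu n hn).symm

lemma tendsto_zero_of_sq {u : ℕ → ℝ} (h : Tendsto (fun n => u n ^ 2) atTop (𝓝 0)) :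
    Tendsto u atTop (𝓝 0) := by
  rw [tendsto_zero_iff_abs_tendsto_zero]
  simpa only [comp_def, Real.sqrt_sq_eq_abs, Real.sqrt_zero] using h.sqrt

lemma tendsto_scaledCentralMoment_three :
    Tendsto (fun n => scaledCentralMoment n 1 3) atTop (𝓝 0) := by
  let g : ℝ × ℝ → ℝ := fun p => 72 * p.2 / (2 + p.1) ^ 3
  have hg : ContinuousAt g (0, 0) :=
    ContinuousAt.div (by fun_prop) (by fun_prop) (by norm_num)
  refine tendsto_zero_of_sq ?_
  convert tendsto_of_eq_inv_natCast_inv_two_pow hg fun n hn => ?_ using 2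
  · norm_num [g]
  · have hn' : (n : ℝ) ≠ 0 := Nat.cast_ne_zero.2 hn
    rw [scaledCentralMoment_sq, centralMoment_three_numSubcubes_one, variance_numSubcubes_one]
    simp only [g]
    field_simp
    ring

lemma tendsto_scaledCentralMoment_four :
    Tendsto (fun n => scaledCentralMoment n 1 4) atTop (𝓝 3) := by
  let g : ℝ × ℝ → ℝ := fun (a, b) =>
    (12 + 12 * a + 40 * b + 3 * a ^ 2 - 48 * a * b + 12 * a ^ 2 * b - 16 * a ^ 3 * b) / (2 + a) ^ 2
  have hg : ContinuousAt g (0, 0) :=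
    ContinuousAt.div (by fun_prop) (by fun_prop) (by norm_num)
  convert tendsto_of_eq_inv_natCast_inv_two_pow hg fun n hn => ?_ using 2
  · norm_num [g]
  · have hn' : (n : ℝ) ≠ 0 := Nat.cast_ne_zero.2 hn
    rw [scaledCentralMoment_two_mul n 1 2, centralMoment_four_numSubcubes_one,
      variance_numSubcubes_one]
    simp only [g]
    field_simp
    ring

lemma tendsto_scaledCentralMoment_five :
    Tendsto (fun n => scaledCentralMoment n 1 5) atTop (𝓝 0) := by
  let g : ℝ × ℝ → ℝ := fun (a, b) =>
    800 * b * (6 + 3 * a + 4 * b - 24 * a * b + 8 * a ^ 2 * b) ^ 2 / (2 + a) ^ 5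
  have hg : ContinuousAt g (0, 0) :=
    ContinuousAt.div (by fun_prop) (by fun_prop) (by norm_num)
  refine tendsto_zero_of_sq ?_
  convert tendsto_of_eq_inv_natCast_inv_two_pow hg fun n hn => ?_ using 2
  · norm_num [g]
  · have hn' : (n : ℝ) ≠ 0 := Nat.cast_ne_zero.2 hn
    rw [scaledCentralMoment_sq, centralMoment_five_numSubcubes_one, variance_numSubcubes_one]
    simp only [g]
    field_simp
    ring

lemma tendsto_scaledCentralMoment_six :
    Tendsto (fun n => scaledCentralMoment n 1 6) atTop (𝓝 15) := by
  let g : ℝ × ℝ → ℝ := fun (a, b) =>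
    (120 + 180 * a + 1920 * b + 90 * a ^ 2 - 840 * a * b - 1792 * b ^ 2 + 15 * a ^ 3
      - 360 * a ^ 2 * b - 5280 * a * b ^ 2 - 300 * a ^ 3 * b + 3840 * a ^ 2 * b ^ 2
      - 240 * a ^ 4 * b + 3840 * a ^ 3 * b ^ 2 - 6720 * a ^ 4 * b ^ 2 + 4864 * a ^ 5 * b ^ 2) /
      (2 + a) ^ 3
  have hg : ContinuousAt g (0, 0) :=
    ContinuousAt.div (by fun_prop) (by fun_prop) (by norm_num)
  convert tendsto_of_eq_inv_natCast_inv_two_pow hg fun n hn => ?_ using 2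
  · norm_num [g]
  · have hn' : (n : ℝ) ≠ 0 := Nat.cast_ne_zero.2 hn
    rw [scaledCentralMoment_two_mul n 1 3, centralMoment_six_numSubcubes_one,
      variance_numSubcubes_one]
    simp only [g]
    field_simp
    ring

end Limits

theorem mainTheorem3 :
    (∀ n : ℕ,
      ProbabilityTheory.centralMoment (numSubcubes n 1) 3 (randomSubset n) =
        3 * (n : ℝ) ^ 3 * 2 ^ n / 64) ∧
    (∀ n : ℕ,
      ProbabilityTheory.centralMoment (numSubcubes n 1) 4 (randomSubset n) =
        (n : ℝ) * 2 ^ n / 1024 *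
          (12 * (n : ℝ) ^ 3 * 2 ^ n + 12 * (n : ℝ) ^ 2 * 2 ^ n + 40 * (n : ℝ) ^ 3
            + 3 * (n : ℝ) * 2 ^ n - 48 * (n : ℝ) ^ 2 + 12 * (n : ℝ) - 16)) ∧
    (∀ n : ℕ,
      ProbabilityTheory.centralMoment (numSubcubes n 1) 5 (randomSubset n) =
        5 * (n : ℝ) ^ 3 * 2 ^ n / 1024 *
          (6 * (n : ℝ) ^ 2 * 2 ^ n + 3 * (n : ℝ) * 2 ^ n + 4 * (n : ℝ) ^ 2
            - 24 * (n : ℝ) + 8)) ∧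
    (∀ n : ℕ,
      ProbabilityTheory.centralMoment (numSubcubes n 1) 6 (randomSubset n) =
        (n : ℝ) * 2 ^ n / 32768 *
          (120 * (n : ℝ) ^ 5 * (2 ^ n) ^ 2 + 180 * (n : ℝ) ^ 4 * (2 ^ n) ^ 2
            + 1920 * (n : ℝ) ^ 5 * 2 ^ n + 90 * (n : ℝ) ^ 3 * (2 ^ n) ^ 2
            - 840 * (n : ℝ) ^ 4 * 2 ^ n - 1792 * (n : ℝ) ^ 5
            + 15 * (n : ℝ) ^ 2 * (2 ^ n) ^ 2 - 360 * (n : ℝ) ^ 3 * 2 ^ n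
            - 5280 * (n : ℝ) ^ 4 - 300 * (n : ℝ) ^ 2 * 2 ^ n + 3840 * (n : ℝ) ^ 3
            - 240 * (n : ℝ) * 2 ^ n + 3840 * (n : ℝ) ^ 2 - 6720 * (n : ℝ) + 4864)) ∧
    Filter.Tendsto (fun n : ℕ => scaledCentralMoment n 1 3) Filter.atTop (nhds 0) ∧
    Filter.Tendsto (fun n : ℕ => scaledCentralMoment n 1 4) Filter.atTop (nhds 3) ∧
    Filter.Tendsto (fun n : ℕ => scaledCentralMoment n 1 5) Filter.atTop (nhds 0) ∧
    Filter.Tendsto (fun n : ℕ => scaledCentralMoment n 1 6) Filter.atTop (nhds 15) :=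
  ⟨centralMoment_three_numSubcubes_one, centralMoment_four_numSubcubes_one,
    centralMoment_five_numSubcubes_one, centralMoment_six_numSubcubes_one,
    tendsto_scaledCentralMoment_three, tendsto_scaledCentralMoment_four,
    tendsto_scaledCentralMoment_five, tendsto_scaledCentralMoment_six⟩
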